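/- Let $\Omega=[0,1]^2$ with periodic boundary conditions, and for $s\in\mathbb{Z}$ let $\dot H^{s}=\dot H^{s}(\Omega)$ be the Sobolev space of real periodic distributions of mean zero on $\Omega$ with norm $\big(\sum_{k\in\mathbb{Z}^2\setminus\{0\}}|2\pi k|^{2s}|\hat u(k)|^2\big)^{1/2}$ (so $\dot H^{-1}$ is the dual of $\dot H^{1}$). Let $\alpha>0$ and consider the regularized surface quasi-geostrophic problem \[ (1-\alpha^2\Delta)\theta=\tilde\theta,\qquad \partial_t\tilde\theta+\operatorname{div}(\mathbf v\,\theta)=0,\qquad (-\Delta)^{1/2}\psi=\theta,\qquad \mathbf v=\nabla^{\perp}\psi, \] \[ \int_\Omega\theta\,dx=0,\qquad \int_\Omega\psi\,dx=0,\qquad \theta(\cdot,0)=\theta_0 , \] where $(-\Delta)^{1/2}$ is the Fourier multiplier whose symbol is the length of the wave vector and $\nabla^\perp=(-\partial_2,\partial_1)$. A global solution is a function $\theta\in C^1((-\infty,\infty),\dot H^1)$ satisfying these equations, the evolution equation holding in $\dot H^{-1}$ at every time. **Theorem (Regularity).** Let $m\ge 1$ be an integer and let $\theta_0\in H^m(\Omega)$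 be real-valued with $\int_\Omega\theta_0\,dx=0$. Then the regularized problem with initial value $\theta_0$ has exactly one global solution $\theta$, and this solution satisfies \[ \theta\in C^1\big((-\infty,\infty),\dot H^m\big)\qquad\text{and}\qquad \tilde\theta=(1-\alpha^2\Delta)\theta\in C^1\big((-\infty,\infty),\dot H^{m-2}\big). \] -/

import Mathlib

open MeasureTheory
open scoped ComplexConjugate

namespace SQG

/-- The periodic square `Ω = [0,1]²`, that is the torus `(ℝ/ℤ)²`. -/
abbrev Torus : Type := UnitAddTorus (Fin 2)

/-- Lebesgue measure on the periodic square (total mass one). -/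
noncomputable abbrev torusMeasure : Measure Torus :=
  Measure.pi fun _ : Fin 2 => AddCircle.haarAddCircle

/-- Real-valued square integrable functions on the periodic square. -/
abbrev L2 : Type := Lp ℝ 2 torusMeasure

/-- Families of Fourier coefficients indexed by `ℤ²`. A periodic distribution
`∑ c k * exp (2πi k·x)` is identified with its family of coefficients `c`. -/
abbrev Coeffs : Type := (Fin 2 → ℤ) → ℂ

/-- Fourier coefficients of a real-valued function:
`∫_Ω u(x) exp (-2πi k·x) dx`. -/
noncomputable def fourierCoeffs (u : Torus → ℝ) : Coeffs :=
  fun k => ∫ x, UnitAddTorus.mFourier (-k) x * (u x : ℂ) ∂torusMeasure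

/-- The wave vector `2πk` of the mode `exp (2πi k·x)`. -/
noncomputable def waveVector (k : Fin 2 → ℤ) : EuclideanSpace ℝ (Fin 2) :=
  WithLp.toLp 2 fun j => 2 * Real.pi * (k j : ℝ)

/-- The partial derivative `∂_j` of a periodic distribution. -/
noncomputable def partialDeriv (j : Fin 2) (c : Coeffs) : Coeffs :=
  fun k => Complex.I * (waveVector k j : ℂ) * c k

/-- The Laplacian `Δ = ∂₁² + ∂₂²`. -/
noncomputable def laplacian (c : Coeffs) : Coeffs :=
  ∑ j, partialDeriv j (partialDeriv j c)

/-- The pseudo-differential operator `(-Δ)^{1/2}`, with symbol the length of the wave vector. -/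
noncomputable def sqrtNegLaplacian (c : Coeffs) : Coeffs :=
  fun k => (‖waveVector k‖ : ℂ) * c k

/-- The operator `∇^⊥ = (-∂₂, ∂₁)`. -/
noncomputable def gradPerp (c : Coeffs) : Fin 2 → Coeffs :=
  ![-partialDeriv 1 c, partialDeriv 0 c]

/-- The divergence of a vector field. -/
noncomputable def divergence (w : Fin 2 → Coeffs) : Coeffs :=
  ∑ j, partialDeriv j (w j)

/-- The operator `1 - α² Δ`. -/
noncomputable def helmholtz (α : ℝ) (c : Coeffs) : Coeffs :=
  c - ((α ^ 2 : ℝ) : ℂ) • laplacian c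

/-- The weighted coefficients `|2πk|^s c(k)`. -/
noncomputable def weighted (s : ℤ) : Coeffs →ₗ[ℝ] Coeffs where
  toFun c := fun k => ((‖waveVector k‖ ^ s : ℝ) : ℂ) * c k
  map_add' c d := by
    funext k
    simp [mul_add]
  map_smul' a c := by
    funext k
    simp [mul_left_comm]

/-- The real, mean zero periodic distributions with `∑ |2πk|^{2s} |c(k)|² < ∞`. -/
noncomputable def hdotSubmodule (s : ℤ) : Submodule ℝ Coeffs where
  carrier := {c | c 0 = 0 ∧ (∀ k, c (-k) = conj (c k)) ∧
    Memℓp (fun k => weighted s c k) 2}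
  zero_mem' := by
    refine ⟨rfl, fun k => by simp, ?_⟩
    rw [map_zero]
    exact zero_memℓp
  add_mem' := by
    rintro c d ⟨hc0, hc, hcs⟩ ⟨hd0, hd, hds⟩
    refine ⟨by simp [hc0, hd0], fun k => by simp [hc, hd], ?_⟩
    rw [map_add]
    exact hcs.add hds
  smul_mem' := by
    rintro a c ⟨hc0, hc, hcs⟩
    refine ⟨by simp [hc0], fun k => by simp [hc], ?_⟩
    rw [map_smul]
    exact hcs.const_smul a

/-- The Sobolev space `Ḣ^s` of real, mean zero periodic distributions on the square, `s ∈ ℤ`.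
For `s < 0` it is, through the `L²` pairing, the dual space of `Ḣ^{-s}`.
It carries the norm `(∑ |2πk|^{2s} |c(k)|²)^{1/2}` (see the instance below). -/
def Hdot (s : ℤ) : Type := hdotSubmodule s

namespace Hdot

/-- The Fourier coefficients of an element of `Ḣ^s`. -/
def coeffs {s : ℤ} (c : Hdot s) : Coeffs := Subtype.val c

noncomputable instance (s : ℤ) : AddCommGroup (Hdot s) :=
  inferInstanceAs (AddCommGroup (hdotSubmodule s))

noncomputable instance (s : ℤ) : Module ℝ (Hdot s) :=
  inferInstanceAs (Module ℝ (hdotSubmodule s))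

/-- The embedding `c ↦ |2πk|^s c(k)` of `Ḣ^s` into `ℓ²(ℤ²)`. -/
noncomputable def toEll2 (s : ℤ) :
    Hdot s →ₗ[ℝ] lp (fun _ : Fin 2 → ℤ => ℂ) 2 where
  toFun c := ⟨fun k => weighted s c.coeffs k, c.2.2.2⟩
  map_add' c d := by
    ext k
    exact congrFun (map_add (weighted s) c.coeffs d.coeffs) k
  map_smul' a c := by
    ext k
    exact congrFun (map_smul (weighted s) a c.coeffs) k

theorem waveVector_ne_zero {k : Fin 2 → ℤ} (hk : k ≠ 0) : waveVector k ≠ 0 := by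
  intro h
  apply hk
  funext j
  have hj : waveVector k j = 0 := by rw [h]; rfl
  simpa [waveVector, Real.pi_ne_zero] using hj

theorem toEll2_injective (s : ℤ) : Function.Injective (toEll2 s) := by
  intro c d h
  apply Subtype.ext
  funext k
  by_cases hk : k = 0
  · subst hk
    exact c.2.1.trans d.2.1.symm
  · have h1 : weighted s c.coeffs k = weighted s d.coeffs k :=
      congrFun (congrArg Subtype.val h) k
    have hne : ((‖waveVector k‖ ^ s : ℝ) : ℂ) ≠ 0 :=
      Complex.ofReal_ne_zero.mpr (zpow_ne_zero s (norm_ne_zero_iff.mpr (waveVector_ne_zero hk)))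
    exact mul_left_cancel₀ hne h1

/-- The norm of `Ḣ^s` is `‖c‖ = (∑ |2πk|^{2s} |c(k)|²)^{1/2}`. -/
noncomputable instance (s : ℤ) : NormedAddCommGroup (Hdot s) :=
  NormedAddCommGroup.induced (Hdot s) (lp (fun _ : Fin 2 → ℤ => ℂ) 2) (toEll2 s)
    (toEll2_injective s)

noncomputable instance (s : ℤ) : NormedSpace ℝ (Hdot s) :=
  NormedSpace.induced ℝ (Hdot s) (lp (fun _ : Fin 2 → ℤ => ℂ) 2) (toEll2 s)

end Hdot

/-- `c ∈ C¹((-∞,∞), Ḣ^s)`: every `c t` lies in `Ḣ^s`, and `t ↦ c t` is continuously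
differentiable for the norm of `Ḣ^s`. -/
def IsC1In (s : ℤ) (c : ℝ → Coeffs) : Prop :=
  ∃ U : ℝ → Hdot s, (∀ t, (U t).coeffs = c t) ∧ ContDiff ℝ 1 U

/-- `c' = d` on `(-∞,∞)`, as an identity between functions of time with values in `Ḣ^s`. -/
def HasTimeDerivIn (s : ℤ) (c d : ℝ → Coeffs) : Prop :=
  ∃ U V : ℝ → Hdot s, (∀ t, (U t).coeffs = c t) ∧ (∀ t, (V t).coeffs = d t) ∧
    ∀ t, HasDerivAt U (V t) t

/-- `θ` is a global solution, of class `C¹((-∞,∞), Ḣ¹)`, of the regularized surface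
quasi-geostrophic problem
`(1 - α²Δ)θ = θ~`, `∂ₜθ~ + div (v θ) = 0`, `(-Δ)^{1/2} ψ = θ`, `∇^⊥ψ = v`, `∫ψ = 0`, `∫θ = 0`,
`θ(0) = θ₀` with periodic boundary conditions. The evolution equation holds in `Ḣ^{-1}`;
the product `v θ` is the pointwise product of functions. -/
structure IsRegularizedSolution (α : ℝ) (θ₀ : L2) (θ : ℝ → L2) : Prop where
  initial : θ 0 = θ₀
  mean_zero : ∀ t, ∫ x, θ t x ∂torusMeasure = 0
  regular : IsC1In 1 fun t => fourierCoeffs (θ t)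
  evolution : ∃ (ψ : ℝ → L2) (v : ℝ → Fin 2 → L2),
    (∀ t, ∫ x, ψ t x ∂torusMeasure = 0) ∧
    (∀ t, sqrtNegLaplacian (fourierCoeffs (ψ t)) = fourierCoeffs (θ t)) ∧
    (∀ t j, fourierCoeffs (v t j) = gradPerp (fourierCoeffs (ψ t)) j) ∧
    HasTimeDerivIn (-1) (fun t => helmholtz α (fourierCoeffs (θ t)))
      (fun t => -divergence fun j => fourierCoeffs fun x => v t j x * θ t x)

/-- The real function `u` belongs to the Sobolev space `H^m` of the periodic square:
`∑ (1 + |2πk|²)^m |u^(k)|² < ∞`. -/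
def MemH (m : ℕ) (u : L2) : Prop :=
  Summable fun k => (1 + ‖waveVector k‖ ^ 2) ^ m * ‖fourierCoeffs u k‖ ^ 2

end SQG

/-!
In Fourier variables the problem is an ordinary differential equation `θ' = B(θ, θ)`, where
`B(f, g) = -(1 - α²Δ)⁻¹ div (∇^⊥(-Δ)^{-1/2} f · g)`. As `∇^⊥(-Δ)^{-1/2}` has order zero and
`(1 - α²Δ)⁻¹ div` gains one derivative, `B` is a bounded bilinear map on `Ḣ^m` as soon as the
product maps `H^m × H^m` to `H^{m-1}`. This follows from `|k| ≤ |j| + |k - j|` and the case `m = 1`,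
in which the convolution of the Fourier coefficients is estimated by Cauchy–Schwarz and
`∑ |k|⁻⁴ < ∞` over `ℤ² \ {0}` (`convolution_sq_bound`). The Picard–Lindelöf theorem then gives
local solutions in each `Ḣ^m`, and uniqueness in `Ḣ¹`.

Solutions are global for two reasons. Since the velocity is divergence free, `∫ div (v θ) θ = 0`
(`SQG.tsum_conj_mul_transport_eq_zero`), so that the energy `‖θ‖² + α² ‖∇θ‖²` is conserved and the
norm of `Ḣ¹` stays bounded (`SQG.Hdot.norm_energyMap_eq`). Moreover `B` satisfies the tame estimate
`‖B(f, f)‖_m ≤ C ‖f‖_1 ‖f‖_m` (`SQG.Hdot.norm_nonlinearity_self_le`), so that by Grönwall's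
inequality the norm of `Ḣ^m` grows at most exponentially; a solution bounded on bounded intervals
can be continued (`exists_global_solution`).

The passage between functions and coefficients rests on the Riesz–Fischer theorem and on the fact
that the coefficients of a product of two square integrable functions are the convolution of theirs
(`SQG.hasSum_fourierCoeffs_mul`). Thus every solution in the sense of `SQG.IsRegularizedSolution`
solves the differential equation in `Ḣ¹`, and a solution of the differential equation in `Ḣ^m`
is a solution of the problem with the asserted regularity.
-/

/-! ### Global solutions of autonomous differential equations -/

section GlobalODE

open Set Metric
open scoped NNReal

variable {X : Type*} [NormedAddCommGroup X] [NormedSpace ℝ X]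

/-- `u` solves the autonomous equation `u' = F u` on the open interval `(a, b)`. -/
def SolvesOn (F : X → X) (u : ℝ → X) (a b : ℝ) : Prop :=
  ∀ t ∈ Ioo a b, HasDerivAt u (F (u t)) t

theorem SolvesOn.mono {F : X → X} {u : ℝ → X} {a b a' b' : ℝ} (hu : SolvesOn F u a b)
    (ha : a ≤ a') (hb : b' ≤ b) : SolvesOn F u a' b' :=
  fun t ht => hu t ⟨ha.trans_lt ht.1, ht.2.trans_le hb⟩

theorem SolvesOn.eqOn {F : X → X} (hF : ∀ R : ℝ, ∃ K : ℝ≥0, LipschitzOnWith K F (closedBall 0 R))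
    {u w : ℝ → X} {a b t₀ : ℝ} (hu : SolvesOn F u a b) (hw : SolvesOn F w a b)
    (ht₀ : t₀ ∈ Ioo a b) (h : u t₀ = w t₀) : EqOn u w (Ioo a b) := by
  intro t ht
  -- On a compact subinterval around `t` and `t₀` both solutions stay in one ball, where `F` is
  -- Lipschitz.
  obtain ⟨c, hac, hc⟩ := exists_between (lt_min ht.1 ht₀.1)
  obtain ⟨d, hd, hdb⟩ := exists_between (max_lt ht.2 ht₀.2)
  rw [lt_min_iff] at hc
  rw [max_lt_iff] at hd
  have hsub : Icc c d ⊆ Ioo a b := fun s hs => ⟨hac.trans_le hs.1, hs.2.trans_lt hdb⟩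
  have bdd : ∀ v : ℝ → X, SolvesOn F v a b → ∃ R, ∀ s ∈ Icc c d, ‖v s‖ ≤ R := fun v hv =>
    isCompact_Icc.exists_bound_of_continuousOn
      fun s hs => (hv s (hsub hs)).continuousAt.continuousWithinAt
  obtain ⟨R₁, hR₁⟩ := bdd u hu
  obtain ⟨R₂, hR₂⟩ := bdd w hw
  obtain ⟨K, hK⟩ := hF (max R₁ R₂)
  refine ODE_solution_unique_of_mem_Ioo (v := fun _ => F) (s := fun _ => closedBall 0 (max R₁ R₂))
    (a := c) (b := d) (fun _ _ => hK) ⟨hc.2, hd.2⟩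
    (fun s hs => ⟨hu s (hsub ⟨hs.1.le, hs.2.le⟩), ?_⟩)
    (fun s hs => ⟨hw s (hsub ⟨hs.1.le, hs.2.le⟩), ?_⟩) h ⟨hc.1, hd.1⟩
  · exact mem_closedBall_zero_iff.2 ((hR₁ s ⟨hs.1.le, hs.2.le⟩).trans (le_max_left _ _))
  · exact mem_closedBall_zero_iff.2 ((hR₂ s ⟨hs.1.le, hs.2.le⟩).trans (le_max_right _ _))

/-- Two solutions that agree on the overlap of their intervals glue to one solution. -/
theorem SolvesOn.glue {F : X → X} {u w : ℝ → X} {a b c d : ℝ} (hu : SolvesOn F u a b)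
    (hw : SolvesOn F w c d) (hcb : c < b) (h : EqOn u w (Ioo c b)) :
    ∃ v, SolvesOn F v a d ∧ EqOn v u (Iio b) ∧ EqOn v w (Ioi c) := by
  obtain ⟨e, hce, heb⟩ := exists_between hcb
  obtain ⟨v, h1, h2⟩ : ∃ v : ℝ → X, EqOn v u (Iio b) ∧ EqOn v w (Ioi c) := by
    refine ⟨fun t => if t < e then u t else w t, fun t ht => ?_, fun t ht => ?_⟩
    · by_cases hte : t < e
      · simp [hte]
      · simpa [hte] using (h ⟨hce.trans_le (not_lt.1 hte), ht⟩).symm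
    · by_cases hte : t < e
      · simpa [hte] using h ⟨ht, hte.trans heb⟩
      · simp [hte]
  refine ⟨v, fun t ht => ?_, h1, h2⟩
  by_cases htb : t < b
  · have := hu t ⟨ht.1, htb⟩
    rw [h1 htb]
    exact this.congr_of_eventuallyEq (h1.eventuallyEq_of_mem (Iio_mem_nhds htb))
  · have htc : c < t := hcb.trans_le (not_lt.1 htb)
    have := hw t ⟨htc, ht.2⟩
    rw [h2 htc]
    exact this.congr_of_eventuallyEq (h2.eventuallyEq_of_mem (Ioi_mem_nhds htc))

/-- The time of existence is bounded below on bounded sets of initial values. -/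
theorem exists_solvesOn_of_norm_le [CompleteSpace X] {F : X → X}
    (hF : ∀ R : ℝ, ∃ K : ℝ≥0, LipschitzOnWith K F (closedBall 0 R)) (R : ℝ) :
    ∃ ε > 0, ∀ x : X, ‖x‖ ≤ R → ∀ t₀, ∃ w, w t₀ = x ∧ SolvesOn F w (t₀ - ε) (t₀ + ε) := by
  obtain ⟨K, hK⟩ := hF (R + 1)
  let L : ℝ≥0 := ‖F 0‖₊ + K * (|R| + 1).toNNReal
  refine ⟨1 / (L + 1), by positivity, fun x hx t₀ => ?_⟩
  have hε : (0 : ℝ) < 1 / (L + 1) := by positivity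
  have hsub : closedBall x ((1 : ℝ≥0) : ℝ) ⊆ closedBall 0 (R + 1) := by
    intro y hy
    rw [mem_closedBall_zero_iff]
    have h1 : ‖y - x‖ ≤ 1 := by simpa [dist_eq_norm] using hy
    calc ‖y‖ = ‖(y - x) + x‖ := by simp
      _ ≤ ‖y - x‖ + ‖x‖ := norm_add_le _ _
      _ ≤ R + 1 := by linarith
  have hpl : IsPicardLindelof (fun _ => F) (tmin := t₀ - 1 / (L + 1)) (tmax := t₀ + 1 / (L + 1))
      ⟨t₀, by linarith, by linarith⟩ x 1 0 L K := by
    refine IsPicardLindelof.of_time_independent (fun y hy => ?_) (hK.mono hsub) ?_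
    · have hy' := hsub hy
      have h0 : (0 : X) ∈ closedBall (0 : X) (R + 1) := by
        rw [mem_closedBall_zero_iff] at hy' ⊢
        simpa using (norm_nonneg y).trans hy'
      have h1 := hK.dist_le_mul y hy' 0 h0
      rw [dist_eq_norm, dist_zero_right] at h1
      rw [mem_closedBall_zero_iff] at hy'
      have h2 : ‖y‖ ≤ |R| + 1 := by linarith [le_abs_self R]
      have h3 : (L : ℝ) = ‖F 0‖ + K * (|R| + 1) := by
        simp [L]
      calc ‖F y‖ = ‖F 0 + (F y - F 0)‖ := by simp
        _ ≤ ‖F 0‖ + ‖F y - F 0‖ := norm_add_le _ _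
        _ ≤ ‖F 0‖ + K * (|R| + 1) := by gcongr; exact h1.trans (by gcongr)
        _ = L := h3.symm
    · simp only [add_sub_cancel_left, sub_sub_cancel, max_self, NNReal.coe_one, NNReal.coe_zero,
        sub_zero]
      rw [mul_one_div, div_le_one (by positivity)]
      linarith
  obtain ⟨w, hw0, hw⟩ := hpl.exists_eq_forall_mem_Icc_hasDerivWithinAt₀
  exact ⟨w, hw0, fun t ht => (hw t ⟨ht.1.le, ht.2.le⟩).hasDerivAt (Icc_mem_nhds ht.1 ht.2)⟩

/-- A solution on `(-a, a)` with values in a ball is continued past both ends by half of the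
existence time which belongs to that ball. -/
theorem SolvesOn.extend {F : X → X}
    (hF : ∀ R : ℝ, ∃ K : ℝ≥0, LipschitzOnWith K F (closedBall 0 R)) {R ε a : ℝ} (hε : 0 < ε)
    (hloc : ∀ x : X, ‖x‖ ≤ R → ∀ t₀, ∃ w, w t₀ = x ∧ SolvesOn F w (t₀ - ε) (t₀ + ε))
    (ha : 0 < a) {u : ℝ → X} (hu : SolvesOn F u (-a) a) (hR : ∀ t ∈ Ioo (-a) a, ‖u t‖ ≤ R) :
    ∃ v, v 0 = u 0 ∧ SolvesOn F v (-(a + ε / 2)) (a + ε / 2) := by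
  -- Restart at `±(a - δ)`: as `δ ≤ ε / 2`, the new solutions reach `±(a + ε / 2)`.
  obtain ⟨δ, hδ, hδa, hδε⟩ : ∃ δ > 0, δ < a ∧ δ ≤ ε / 2 :=
    ⟨min (a / 2) (ε / 2), by positivity, (min_le_left _ _).trans_lt (by linarith), min_le_right _ _⟩
  obtain ⟨w, hw0, hw⟩ := hloc (u (a - δ)) (hR _ ⟨by linarith, by linarith⟩) (a - δ)
  obtain ⟨z, hz0, hz⟩ := hloc (u (-a + δ)) (hR _ ⟨by linarith, by linarith⟩) (-a + δ)
  obtain ⟨v, hv, hvu, -⟩ := hu.glue (c := max (-a) (a - δ - ε)) (d := a + ε / 2)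
    (hw.mono (le_max_right _ _) (by linarith)) (max_lt (by linarith) (by linarith))
    (SolvesOn.eqOn hF (hu.mono (le_max_left _ _) le_rfl)
      (hw.mono (le_max_right _ _) (by linarith))
      (t₀ := a - δ) ⟨max_lt (by linarith) (by linarith), by linarith⟩ hw0.symm)
  have hzv : z (-a + δ) = v (-a + δ) := by rw [hz0, hvu (show -a + δ < a by linarith)]
  have hmin : -a < min a (-a + δ + ε) := lt_min (by linarith) (by linarith)
  obtain ⟨v', hv', -, hv'v⟩ := (hz.mono (a' := -(a + ε / 2)) (b' := min a (-a + δ + ε))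
    (by linarith) (min_le_right _ _)).glue hv hmin
    (SolvesOn.eqOn hF (hz.mono (by linarith) (min_le_right _ _))
      (hv.mono le_rfl ((min_le_left _ _).trans (by linarith)))
      (t₀ := -a + δ) ⟨by linarith, lt_min (by linarith) (by linarith)⟩ hzv)
  exact ⟨v', by rw [hv'v (show -a < 0 by linarith), hvu (show (0 : ℝ) < a by linarith)], hv'⟩

/-- If every solution starting at `x₀` stays bounded on bounded intervals of time, then the
solution is global. -/
theorem exists_global_solution [CompleteSpace X] {F : X → X}
    (hF : ∀ R : ℝ, ∃ K : ℝ≥0, LipschitzOnWith K F (closedBall 0 R)) (x₀ : X)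
    (hbound : ∀ T, ∃ R, ∀ a ≤ T, ∀ u, u 0 = x₀ → SolvesOn F u (-a) a →
      ∀ t ∈ Ioo (-a) a, ‖u t‖ ≤ R) :
    ∃ u : ℝ → X, u 0 = x₀ ∧ ∀ t, HasDerivAt u (F (u t)) t := by
  -- On `(-T, T)` all solutions are bounded by the same `R`, so that finitely many continuations by
  -- a fixed length `ε / 2` suffice.
  have key : ∀ T > 0, ∃ u, u 0 = x₀ ∧ SolvesOn F u (-T) T := by
    intro T hT
    obtain ⟨R, hR⟩ := hbound T
    obtain ⟨ε, hε, hloc⟩ := exists_solvesOn_of_norm_le hF (max R ‖x₀‖)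
    have step : ∀ n : ℕ, ∃ u, u 0 = x₀ ∧
        SolvesOn F u (-min T ((n + 1) * (ε / 2))) (min T ((n + 1) * (ε / 2))) := by
      intro n
      induction n with
      | zero =>
        obtain ⟨w, hw0, hw⟩ := hloc x₀ (le_max_right _ _) 0
        have : min T (((0 : ℕ) + 1) * (ε / 2)) ≤ ε / 2 := (min_le_right _ _).trans (by simp)
        exact ⟨w, hw0, hw.mono (by linarith) (by linarith)⟩
      | succ n ih =>
        obtain ⟨u, hu0, hu⟩ := ih
        obtain ⟨v, hv0, hv⟩ := hu.extend hF hε hloc (lt_min hT (by positivity))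
          fun t ht => (hR _ (min_le_left _ _) u hu0 hu t ht).trans (le_max_left _ _)
        have : min T (((n + 1 : ℕ) + 1) * (ε / 2)) ≤ min T ((n + 1) * (ε / 2)) + ε / 2 := by
          rw [← min_add_add_right]
          apply min_le_min
          · linarith
          · push_cast; linarith
        exact ⟨v, hv0.trans hu0, hv.mono (by linarith) (by linarith)⟩
    obtain ⟨n, hn⟩ := exists_nat_ge (T / (ε / 2))
    obtain ⟨u, hu0, hu⟩ := step n
    have : min T ((n + 1) * (ε / 2)) = T := min_eq_left (by
      rw [div_le_iff₀ (by positivity)] at hn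
      linarith)
    rw [this] at hu
    exact ⟨u, hu0, hu⟩
  choose! γ hγ0 hγ using key
  have heq : ∀ a a' : ℝ, 0 < a → a ≤ a' → EqOn (γ a) (γ a') (Ioo (-a) a) := fun a a' ha h =>
    SolvesOn.eqOn hF (hγ a ha) ((hγ a' (ha.trans_le h)).mono (by linarith) h)
      (t₀ := 0) ⟨by linarith, ha⟩ ((hγ0 a ha).trans (hγ0 a' (ha.trans_le h)).symm)
  -- The solutions on the intervals `(-a, a)` are patched together along `t ↦ γ (|t| + 1) t`.
  have heq' : ∀ a : ℝ, 0 < a → EqOn (fun t => γ (|t| + 1) t) (γ a) (Ioo (-a) a) := by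
    intro a ha t ht
    have ht1 : t ∈ Ioo (-(|t| + 1)) (|t| + 1) := abs_lt.1 (lt_add_one _)
    rcases le_total (|t| + 1) a with h | h
    · exact heq _ _ (by positivity) h ht1
    · exact (heq _ _ ha h ht).symm
  refine ⟨fun t => γ (|t| + 1) t, by simpa using hγ0 1 one_pos, fun t => ?_⟩
  have hpos : 0 < |t| + 1 := by positivity
  have ht1 : t ∈ Ioo (-(|t| + 1)) (|t| + 1) := abs_lt.1 (lt_add_one _)
  exact (hγ _ hpos t ht1).congr_of_eventuallyEq
    ((heq' _ hpos).eventuallyEq_of_mem (Ioo_mem_nhds ht1.1 ht1.2))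

/-- Two-sided form of Grönwall's inequality `‖u'‖ ≤ C ‖u‖`. -/
theorem norm_le_mul_exp_of_norm_deriv_le {u u' : ℝ → X} {a C : ℝ}
    (hu : ∀ t ∈ Ioo (-a) a, HasDerivAt u (u' t) t)
    (hC : ∀ t ∈ Ioo (-a) a, ‖u' t‖ ≤ C * ‖u t‖) {t : ℝ} (ht : t ∈ Ioo (-a) a) :
    ‖u t‖ ≤ ‖u 0‖ * Real.exp (C * |t|) := by
  have main : ∀ (w w' : ℝ → X), (∀ s ∈ Ioo (-a) a, HasDerivAt w (w' s) s) →
      (∀ s ∈ Ioo (-a) a, ‖w' s‖ ≤ C * ‖w s‖) → ∀ s, 0 ≤ s → s ∈ Ioo (-a) a →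
      ‖w s‖ ≤ ‖w 0‖ * Real.exp (C * s) := by
    intro w w' hw hC s hs0 hs
    have hsub : Icc 0 s ⊆ Ioo (-a) a := fun r hr =>
      ⟨by linarith [hr.1, hs.2], by linarith [hr.2, hs.2]⟩
    have := norm_le_gronwallBound_of_norm_deriv_right_le (f := w) (f' := w') (δ := ‖w 0‖) (K := C)
      (ε := 0) (a := 0) (b := s)
      (fun r hr => (hw r (hsub hr)).continuousAt.continuousWithinAt)
      (fun r hr => (hw r (hsub ⟨hr.1, hr.2.le⟩)).hasDerivWithinAt) le_rfl
      (fun r hr => by simpa using hC r (hsub ⟨hr.1, hr.2.le⟩)) s ⟨hs0, le_rfl⟩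
    simpa [gronwallBound_ε0] using this
  rcases le_total 0 t with h | h
  · rw [abs_of_nonneg h]
    exact main u u' hu hC t h ht
  · rw [abs_of_nonpos h]
    have := main (fun s => u (-s)) (fun s => -u' (-s))
      (fun s hs => by
        have := (hu (-s) ⟨by linarith [hs.2], by linarith [hs.1]⟩).scomp s (hasDerivAt_neg s)
        simpa [Function.comp_def] using this)
      (fun s hs => by simpa using hC (-s) ⟨by linarith [hs.2], by linarith [hs.1]⟩)
      (-t) (by linarith) ⟨by linarith [ht.2], by linarith [ht.1]⟩
    simpa using this

end GlobalODE

/-! ### Convolution of square summable families -/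

section Convolution

theorem summable_mul_and_sq_tsum_le {ι : Type*} {x y : ι → ℝ} (hx0 : ∀ i, 0 ≤ x i)
    (hy0 : ∀ i, 0 ≤ y i) (hx : Summable fun i => x i ^ 2) (hy : Summable fun i => y i ^ 2) :
    (Summable fun i => x i * y i) ∧
      (∑' i, x i * y i) ^ 2 ≤ (∑' i, x i ^ 2) * ∑' i, y i ^ 2 := by
  have h := Real.summable_and_inner_le_Lp_mul_Lq_tsum_of_nonneg Real.HolderConjugate.two_two hx0 hy0
    (by simpa using hx) (by simpa using hy)
  refine ⟨h.1, ?_⟩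
  have h2 := h.2
  simp only [Real.rpow_two, ← Real.sqrt_eq_rpow] at h2
  have h0 : 0 ≤ ∑' i, x i * y i := tsum_nonneg fun i => mul_nonneg (hx0 i) (hy0 i)
  calc _ ≤ (√(∑' i, x i ^ 2) * √(∑' i, y i ^ 2)) ^ 2 := by gcongr
    _ = _ := by
      rw [mul_pow, Real.sq_sqrt (tsum_nonneg fun i => sq_nonneg _),
        Real.sq_sqrt (tsum_nonneg fun i => sq_nonneg _)]

variable {G : Type*} [AddCommGroup G]

/-- The change of variables `(k, j) ↦ (j, k - j)` which turns a sum over pairs into a sum of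
convolution sums. -/
def convolutionEquiv (G : Type*) [AddCommGroup G] : G × G ≃ G × G where
  toFun p := (p.2, p.1 - p.2)
  invFun p := (p.1 + p.2, p.1)
  left_inv p := by simp
  right_inv p := by simp

/-- The sequence form of the Sobolev multiplication `H¹ · H¹ ⊆ L²`: if `κ ∈ ℓ⁴`, then
`(κ a) * (κ b) ∈ ℓ²` for `a, b ∈ ℓ²`. By Cauchy–Schwarz the square of the convolution at `k` is at
most `∑ κ(j)² κ(k-j)² ≤ ∑ κ⁴` times `∑ a(j)² b(k-j)²`, and the latter is summable over `k`. -/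
theorem convolution_sq_bound {κ a b : G → ℝ} (hκ0 : ∀ j, 0 ≤ κ j) (ha0 : ∀ j, 0 ≤ a j)
    (hb0 : ∀ j, 0 ≤ b j) (hκ : Summable fun j => κ j ^ 4) (ha : Summable fun j => a j ^ 2)
    (hb : Summable fun j => b j ^ 2) :
    (∀ k, Summable fun j => (κ j * a j) * (κ (k - j) * b (k - j))) ∧
    (Summable fun k => (∑' j, (κ j * a j) * (κ (k - j) * b (k - j))) ^ 2) ∧
    ∑' k, (∑' j, (κ j * a j) * (κ (k - j) * b (k - j))) ^ 2 ≤
      (∑' j, κ j ^ 4) * ((∑' j, a j ^ 2) * ∑' j, b j ^ 2) := by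
  have hS0 : 0 ≤ ∑' j, κ j ^ 4 := tsum_nonneg fun j => by positivity
  have hP : ∀ k, (Summable fun j => (κ j * κ (k - j)) ^ 2) ∧
      ∑' j, (κ j * κ (k - j)) ^ 2 ≤ ∑' j, κ j ^ 4 := by
    intro k
    have hshift : (∑' j, (κ (k - j) ^ 2) ^ 2) = ∑' j, (κ j ^ 2) ^ 2 :=
      (Equiv.subLeft k).tsum_eq fun j => (κ j ^ 2) ^ 2
    have hκ' : Summable fun j => (κ j ^ 2) ^ 2 := by simpa [← pow_mul] using hκ
    have h := summable_mul_and_sq_tsum_le (x := fun j => κ j ^ 2) (y := fun j => κ (k - j) ^ 2)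
      (fun j => sq_nonneg _) (fun j => sq_nonneg _) hκ'
      ((Equiv.subLeft k).summable_iff.2 hκ')
    rw [hshift, ← sq] at h
    simp only [← mul_pow] at h
    refine ⟨h.1, ?_⟩
    have h2 := (pow_le_pow_iff_left₀ (tsum_nonneg fun j => sq_nonneg _)
      (tsum_nonneg fun j => sq_nonneg _) two_ne_zero).1 h.2
    simpa only [← pow_mul] using h2
  have hprod : Summable fun p : G × G => a p.1 ^ 2 * b p.2 ^ 2 :=
    Summable.mul_of_nonneg (f := fun j => a j ^ 2) (g := fun j => b j ^ 2) ha hb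
      (fun _ => sq_nonneg _) fun _ => sq_nonneg _
  have hprod' : Summable fun p : G × G => (a p.2 * b (p.1 - p.2)) ^ 2 := by
    refine ((convolutionEquiv G).summable_iff.2 hprod).congr fun p => ?_
    simp [mul_pow, convolutionEquiv]
  have hsum : ∑' k, ∑' j, (a j * b (k - j)) ^ 2 = (∑' j, a j ^ 2) * ∑' j, b j ^ 2 := by
    rw [ha.tsum_mul_tsum hb hprod, ← hprod'.tsum_prod,
      ← (convolutionEquiv G).tsum_eq fun p : G × G => a p.1 ^ 2 * b p.2 ^ 2]
    exact tsum_congr fun p => by simp [mul_pow, convolutionEquiv]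
  have hcs : ∀ k, (Summable fun j => (κ j * a j) * (κ (k - j) * b (k - j))) ∧
      (∑' j, (κ j * a j) * (κ (k - j) * b (k - j))) ^ 2 ≤
        (∑' j, κ j ^ 4) * ∑' j, (a j * b (k - j)) ^ 2 := by
    intro k
    have h := summable_mul_and_sq_tsum_le (x := fun j => κ j * κ (k - j))
      (y := fun j => a j * b (k - j)) (fun j => mul_nonneg (hκ0 _) (hκ0 _))
      (fun j => mul_nonneg (ha0 _) (hb0 _)) (hP k).1 (hprod'.prod_factor k)
    have e : (fun j => κ j * κ (k - j) * (a j * b (k - j))) =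
        fun j => (κ j * a j) * (κ (k - j) * b (k - j)) := by
      funext j; ring
    rw [e] at h
    exact ⟨h.1, h.2.trans (mul_le_mul_of_nonneg_right (hP k).2 (tsum_nonneg fun _ => sq_nonneg _))⟩
  have hmaj : Summable fun k => (∑' j, κ j ^ 4) * ∑' j, (a j * b (k - j)) ^ 2 :=
    (hprod'.prod).mul_left _
  have hs := Summable.of_nonneg_of_le (fun k => sq_nonneg _) (fun k => (hcs k).2) hmaj
  refine ⟨fun k => (hcs k).1, hs, (hs.tsum_le_tsum (fun k => (hcs k).2) hmaj).trans_eq ?_⟩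
  rw [tsum_mul_left, hsum]

end Convolution

namespace SQG

/-! ### Wave vectors -/

theorem waveVector_apply (k : Fin 2 → ℤ) (j : Fin 2) :
    waveVector k j = 2 * Real.pi * (k j : ℝ) := rfl

theorem waveVector_add (j k : Fin 2 → ℤ) : waveVector (j + k) = waveVector j + waveVector k := by
  ext i
  simp [waveVector_apply, mul_add]

theorem waveVector_neg (k : Fin 2 → ℤ) : waveVector (-k) = -waveVector k := by
  ext i
  simp [waveVector_apply]

theorem waveVector_sub (j k : Fin 2 → ℤ) : waveVector (j - k) = waveVector j - waveVector k := by
  rw [sub_eq_add_neg, waveVector_add, waveVector_neg, sub_eq_add_neg]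

@[simp]
theorem waveVector_zero : waveVector 0 = 0 := by
  ext i
  simp [waveVector_apply]

theorem norm_waveVector_sq (k : Fin 2 → ℤ) :
    ‖waveVector k‖ ^ 2 = waveVector k 0 ^ 2 + waveVector k 1 ^ 2 := by
  simp [EuclideanSpace.norm_sq_eq]

theorem norm_le_norm_waveVector (k : Fin 2 → ℤ) : ‖k‖ ≤ ‖waveVector k‖ := by
  refine (pi_norm_le_iff_of_nonneg (norm_nonneg _)).2 fun i => ?_
  refine le_trans ?_ (PiLp.norm_apply_le (waveVector k) i)
  rw [waveVector_apply, norm_mul, Real.norm_of_nonneg (by positivity)]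
  have h : (1 : ℝ) ≤ 2 * Real.pi := by linarith [Real.pi_gt_three]
  exact le_mul_of_one_le_left (norm_nonneg _) h

theorem one_le_norm_waveVector {k : Fin 2 → ℤ} (hk : k ≠ 0) : 1 ≤ ‖waveVector k‖ := by
  refine le_trans ?_ (norm_le_norm_waveVector k)
  obtain ⟨i, hi⟩ := Function.ne_iff.1 hk
  refine le_trans ?_ (norm_le_pi_norm k i)
  rw [Int.norm_eq_abs]
  exact_mod_cast Int.one_le_abs hi

theorem summable_norm_waveVector_inv_pow_four :
    Summable fun k : Fin 2 → ℤ => (‖waveVector k‖⁻¹) ^ 4 := by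
  have h := EisensteinSeries.summable_one_div_norm_rpow (k := 4) (by norm_num)
  refine h.of_nonneg_of_le (fun k => by positivity) fun k => ?_
  have e : ‖k‖ ^ (-4 : ℝ) = (‖k‖⁻¹) ^ 4 := by
    rw [Real.rpow_neg (norm_nonneg _), inv_pow]
    norm_cast
  rw [e]
  by_cases hk : k = 0
  · simp [hk]
  · have : 0 < ‖k‖ := norm_pos_iff.2 hk
    gcongr
    exact norm_le_norm_waveVector k

/-- `∑ |2πk|⁻⁴` over `k ∈ ℤ² \ {0}`; the term `k = 0` vanishes because `0⁻¹ = 0`. -/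
noncomputable def latticeSum : ℝ := ∑' k : Fin 2 → ℤ, (‖waveVector k‖⁻¹) ^ 4

theorem latticeSum_nonneg : 0 ≤ latticeSum := tsum_nonneg fun _ => by positivity

/-- `∑ |2πk|^{2p} |c(k)|²`, the square of the norm of `Ḣ^p`. -/
noncomputable def sobolevSq (p : ℕ) (c : Coeffs) : ℝ :=
  ∑' k, (‖waveVector k‖ ^ p * ‖c k‖) ^ 2

/-- The weights `|2πj|^p` and `|2π(k-j)|^q` are absorbed into the factors, at the cost of one
derivative on each of them. -/
theorem weightedConvolution_bound {p q : ℕ} {f g : Coeffs} (hf0 : f 0 = 0) (hg0 : g 0 = 0)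
    (hf : Summable fun k => (‖waveVector k‖ ^ (p + 1) * ‖f k‖) ^ 2)
    (hg : Summable fun k => (‖waveVector k‖ ^ (q + 1) * ‖g k‖) ^ 2) :
    (∀ k, Summable fun j =>
      (‖waveVector j‖ ^ p * ‖f j‖) * (‖waveVector (k - j)‖ ^ q * ‖g (k - j)‖)) ∧
    (Summable fun k => (∑' j,
      (‖waveVector j‖ ^ p * ‖f j‖) * (‖waveVector (k - j)‖ ^ q * ‖g (k - j)‖)) ^ 2) ∧
    ∑' k, (∑' j,
      (‖waveVector j‖ ^ p * ‖f j‖) * (‖waveVector (k - j)‖ ^ q * ‖g (k - j)‖)) ^ 2 ≤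
      latticeSum * (sobolevSq (p + 1) f * sobolevSq (q + 1) g) := by
  have key : ∀ {r : ℕ} {c : Coeffs}, c 0 = 0 → ∀ k,
      ‖waveVector k‖⁻¹ * (‖waveVector k‖ ^ (r + 1) * ‖c k‖) = ‖waveVector k‖ ^ r * ‖c k‖ := by
    intro r c hc k
    by_cases hk : k = 0
    · simp [hk, hc]
    · have : ‖waveVector k‖ ≠ 0 := by linarith [one_le_norm_waveVector hk]
      rw [pow_succ']
      field_simp
  have h := convolution_sq_bound (κ := fun k => ‖waveVector k‖⁻¹) (fun _ => by positivity)
    (fun _ => by positivity) (fun _ => by positivity) summable_norm_waveVector_inv_pow_four hf hg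
  simp only [key hf0, key hg0] at h
  exact h

/-! ### The Sobolev spaces -/

theorem memlp_two_iff {c : Coeffs} : Memℓp c 2 ↔ Summable fun k => ‖c k‖ ^ 2 := by
  rw [memℓp_gen_iff (by simp)]
  simp

theorem norm_weighted (s : ℤ) (c : Coeffs) (k : Fin 2 → ℤ) :
    ‖weighted s c k‖ = ‖waveVector k‖ ^ s * ‖c k‖ := by
  simp [weighted]

theorem mem_hdotSubmodule_iff {s : ℤ} {c : Coeffs} :
    c ∈ hdotSubmodule s ↔ c 0 = 0 ∧ (∀ k, c (-k) = conj (c k)) ∧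
      Summable fun k => (‖waveVector k‖ ^ s * ‖c k‖) ^ 2 := by
  change (_ ∧ _ ∧ Memℓp (weighted s c) 2) ↔ _
  rw [memlp_two_iff]
  simp only [norm_weighted]

namespace Hdot

variable {s : ℤ}

/-- The element of `Ḣ^s` with the given Fourier coefficients. -/
def mk (c : Coeffs) (hc : c ∈ hdotSubmodule s) : Hdot s := ⟨c, hc⟩

@[simp]
theorem coeffs_mk (c : Coeffs) (hc : c ∈ hdotSubmodule s) : (mk c hc).coeffs = c := rfl

@[ext]
theorem ext {c d : Hdot s} (h : c.coeffs = d.coeffs) : c = d := Subtype.ext h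

@[simp]
theorem coeffs_add (c d : Hdot s) : (c + d).coeffs = c.coeffs + d.coeffs := rfl

@[simp]
theorem coeffs_smul (a : ℝ) (c : Hdot s) : (a • c).coeffs = a • c.coeffs := rfl

theorem coeffs_zero_apply (c : Hdot s) : c.coeffs 0 = 0 := c.2.1

theorem coeffs_neg_apply (c : Hdot s) (k : Fin 2 → ℤ) : c.coeffs (-k) = conj (c.coeffs k) :=
  c.2.2.1 k

theorem summable_coeffs (c : Hdot s) :
    Summable fun k => (‖waveVector k‖ ^ s * ‖c.coeffs k‖) ^ 2 :=
  (mem_hdotSubmodule_iff.1 c.2).2.2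

theorem norm_toEll2 (c : Hdot s) : ‖toEll2 s c‖ = ‖c‖ := rfl

theorem norm_sq_eq (c : Hdot s) :
    ‖c‖ ^ 2 = ∑' k, (‖waveVector k‖ ^ s * ‖c.coeffs k‖) ^ 2 := by
  have h := lp.norm_rpow_eq_tsum (p := 2) (by simp) (toEll2 s c)
  rw [norm_toEll2] at h
  simp only [ENNReal.toReal_ofNat, Real.rpow_two] at h
  rw [h]
  exact tsum_congr fun k => by rw [← norm_weighted]; rfl

/-- The embedding of `Ḣ^s` into `ℓ²` as a linear isometry. -/
noncomputable def toEll2Isometry (s : ℤ) :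
    Hdot s →ₗᵢ[ℝ] lp (fun _ : Fin 2 → ℤ => ℂ) 2 :=
  ⟨toEll2 s, fun _ => rfl⟩

theorem toEll2_apply (c : Hdot s) (k : Fin 2 → ℤ) :
    toEll2 s c k = ((‖waveVector k‖ ^ s : ℝ) : ℂ) * c.coeffs k := rfl

theorem range_toEll2 (s : ℤ) : Set.range (toEll2 s) =
    {w : lp (fun _ : Fin 2 → ℤ => ℂ) 2 | w 0 = 0 ∧ ∀ k, w (-k) = conj (w k)} := by
  ext w
  constructor
  · rintro ⟨c, rfl⟩
    refine ⟨by simp [toEll2_apply, coeffs_zero_apply], fun k => ?_⟩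
    simp [toEll2_apply, coeffs_neg_apply, waveVector_neg]
  · rintro ⟨hw0, hw⟩
    have hW : ∀ k : Fin 2 → ℤ, k ≠ 0 → ((‖waveVector k‖ ^ s : ℝ) : ℂ) ≠ 0 := fun k hk =>
      Complex.ofReal_ne_zero.2 (zpow_ne_zero s (norm_ne_zero_iff.2 (waveVector_ne_zero hk)))
    have key : ∀ k, ((‖waveVector k‖ ^ s : ℝ) : ℂ) *
        (((‖waveVector k‖ ^ s : ℝ) : ℂ)⁻¹ * w k) = w k := by
      intro k
      by_cases hk : k = 0
      · simp [hk, hw0]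
      · rw [mul_inv_cancel_left₀ (hW k hk)]
    refine ⟨mk (fun k => ((‖waveVector k‖ ^ s : ℝ) : ℂ)⁻¹ * w k)
      ⟨by simp [hw0], fun k => ?_, ?_⟩, ?_⟩
    · simp [waveVector_neg, hw]
    · convert lp.memℓp w using 1
      funext k
      exact key k
    · ext k
      exact key k

instance (s : ℤ) : CompleteSpace (Hdot s) := by
  have h : Isometry (toEll2 s) := (toEll2Isometry s).isometry
  rw [completeSpace_iff_isComplete_range h.isUniformInducing, range_toEll2]
  refine IsClosed.isComplete ?_
  have hc : ∀ k, Continuous fun w : lp (fun _ : Fin 2 → ℤ => ℂ) 2 => w k := fun k =>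
    (continuous_apply k).comp lp.uniformContinuous_coe.continuous
  simp only [Set.ofPred_and, Set.ofPred_forall]
  exact (isClosed_eq (hc 0) continuous_const).inter
    (isClosed_iInter fun k => isClosed_eq (hc _) (Complex.continuous_conj.comp (hc k)))

/-- The Fourier multiplier with even real symbol `μ`, as a bounded operator `Ḣ^s → Ḣ^r`. -/
noncomputable def multiplier (s r : ℤ) (μ : (Fin 2 → ℤ) → ℝ) (hμ : ∀ k, μ (-k) = μ k) (C : ℝ)
    (hC : ∀ k, k ≠ 0 → ‖waveVector k‖ ^ r * |μ k| ≤ C * ‖waveVector k‖ ^ s) :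
    Hdot s →L[ℝ] Hdot r :=
  have hle : ∀ (c : Hdot s) k, (‖waveVector k‖ ^ r * ‖(μ k : ℂ) * c.coeffs k‖) ^ 2 ≤
      C ^ 2 * (‖waveVector k‖ ^ s * ‖c.coeffs k‖) ^ 2 := by
    intro c k
    by_cases hk : k = 0
    · simp [hk, coeffs_zero_apply]
    · rw [← mul_pow]
      refine pow_le_pow_left₀ (by positivity) ?_ 2
      calc ‖waveVector k‖ ^ r * ‖(μ k : ℂ) * c.coeffs k‖
          = (‖waveVector k‖ ^ r * |μ k|) * ‖c.coeffs k‖ := by simp [mul_assoc]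
        _ ≤ (C * ‖waveVector k‖ ^ s) * ‖c.coeffs k‖ :=
          mul_le_mul_of_nonneg_right (hC k hk) (norm_nonneg _)
        _ = _ := by ring
  have hsum : ∀ c : Hdot s,
      Summable fun k => (‖waveVector k‖ ^ r * ‖(μ k : ℂ) * c.coeffs k‖) ^ 2 := fun c =>
    .of_nonneg_of_le (fun k => sq_nonneg _) (hle c) (c.summable_coeffs.mul_left _)
  LinearMap.mkContinuous
    { toFun c := mk (fun k => (μ k : ℂ) * c.coeffs k) (mem_hdotSubmodule_iff.2
        ⟨by simp [coeffs_zero_apply], fun k => by simp [coeffs_neg_apply, hμ], hsum c⟩)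
      map_add' c d := by ext k; simp [mul_add]
      map_smul' a c := by ext k; simp [mul_left_comm] }
    |C| fun c => by
      refine (sq_le_sq₀ (norm_nonneg _) (by positivity)).1 ?_
      rw [norm_sq_eq, mul_pow, sq_abs, norm_sq_eq, ← tsum_mul_left]
      exact (hsum c).tsum_le_tsum (hle c) (c.summable_coeffs.mul_left _)

@[simp]
theorem coeffs_multiplier {s r : ℤ} {μ : (Fin 2 → ℤ) → ℝ} {hμ : ∀ k, μ (-k) = μ k} {C : ℝ}
    {hC : ∀ k, k ≠ 0 → ‖waveVector k‖ ^ r * |μ k| ≤ C * ‖waveVector k‖ ^ s} (c : Hdot s)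
    (k : Fin 2 → ℤ) : (multiplier s r μ hμ C hC c).coeffs k = (μ k : ℂ) * c.coeffs k := rfl

/-- The embedding `Ḣ^s ⊆ Ḣ^r` for `r ≤ s`. -/
noncomputable def inclusion {s r : ℤ} (h : r ≤ s) : Hdot s →L[ℝ] Hdot r :=
  multiplier s r (fun _ => 1) (fun _ => rfl) 1 fun k hk => by
    simpa using zpow_le_zpow_right₀ (one_le_norm_waveVector hk) h

@[simp]
theorem coeffs_inclusion {s r : ℤ} (h : r ≤ s) (c : Hdot s) :
    (inclusion h c).coeffs = c.coeffs := by
  funext k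
  simp [inclusion]

theorem norm_inclusion_le {s r : ℤ} (h : r ≤ s) (c : Hdot s) : ‖inclusion h c‖ ≤ ‖c‖ := by
  refine (sq_le_sq₀ (norm_nonneg _) (norm_nonneg _)).1 ?_
  rw [norm_sq_eq, norm_sq_eq]
  refine (inclusion h c).summable_coeffs.tsum_le_tsum (fun k => ?_) c.summable_coeffs
  rw [coeffs_inclusion]
  by_cases hk : k = 0
  · simp [hk, coeffs_zero_apply]
  · gcongr
    exact one_le_norm_waveVector hk

theorem sobolevSq_eq {p : ℕ} (c : Hdot p) : sobolevSq p c.coeffs = ‖c‖ ^ 2 := by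
  simp [norm_sq_eq, sobolevSq]

end Hdot

/-! ### The transport term -/

/-- The symbol `k · j^⊥ / |j|` (up to the factor `2π`) of `-div (∇^⊥ (-Δ)^{-1/2} f · g)`, where
`j` is the frequency of `f` and `k - j` that of `g`. At `j = 0` it vanishes, because
`x / 0 = 0`. -/
noncomputable def transportSymbol (k j : Fin 2 → ℤ) : ℝ :=
  (waveVector k 1 * waveVector j 0 - waveVector k 0 * waveVector j 1) / ‖waveVector j‖

theorem abs_transportSymbol_le (k j : Fin 2 → ℤ) : |transportSymbol k j| ≤ ‖waveVector k‖ := by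
  by_cases hj : j = 0
  · simp [transportSymbol, hj]
  have hpos : 0 < ‖waveVector j‖ := norm_pos_iff.2 (Hdot.waveVector_ne_zero hj)
  rw [transportSymbol, abs_div, abs_norm, div_le_iff₀ hpos]
  refine abs_le_of_sq_le_sq ?_ (by positivity)
  rw [mul_pow, norm_waveVector_sq, norm_waveVector_sq]
  linarith [sq_nonneg (waveVector k 0 * waveVector j 0 + waveVector k 1 * waveVector j 1)]

theorem transportSymbol_neg_neg (k j : Fin 2 → ℤ) :
    transportSymbol (-k) (-j) = transportSymbol k j := by
  simp [transportSymbol, waveVector_neg]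

/-- The symbol is antisymmetric under exchange of the frequencies of the transported function and
of the test function, as the velocity is divergence free. -/
theorem transportSymbol_sub_left (k j : Fin 2 → ℤ) :
    transportSymbol (j - k) j = -transportSymbol k j := by
  simp only [transportSymbol, waveVector_sub, PiLp.sub_apply]
  ring

/-- The Fourier coefficients of `-div (v g)` with `v = ∇^⊥ (-Δ)^{-1/2} f`. -/
noncomputable def transport (f g : Coeffs) : Coeffs :=
  fun k => ∑' j, (transportSymbol k j : ℂ) * (f j * g (k - j))

/-- The symbol `1 + α² |2πk|²` of `1 - α² Δ`. -/
noncomputable def helmholtzSymbol (α : ℝ) (k : Fin 2 → ℤ) : ℝ := 1 + α ^ 2 * ‖waveVector k‖ ^ 2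

theorem helmholtzSymbol_pos (α : ℝ) (k : Fin 2 → ℤ) : 0 < helmholtzSymbol α k := by
  unfold helmholtzSymbol
  positivity

theorem helmholtzSymbol_neg (α : ℝ) (k : Fin 2 → ℤ) :
    helmholtzSymbol α (-k) = helmholtzSymbol α k := by
  simp [helmholtzSymbol, waveVector_neg]

/-- The bilinear map `(f, g) ↦ -(1 - α² Δ)⁻¹ div (v g)` with `v = ∇^⊥ (-Δ)^{-1/2} f`. -/
noncomputable def regTransport (α : ℝ) (f g : Coeffs) : Coeffs :=
  fun k => ((helmholtzSymbol α k)⁻¹ : ℂ) * transport f g k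

theorem transport_zero_apply (f g : Coeffs) : transport f g 0 = 0 := by
  simp [transport, transportSymbol]

theorem transport_neg_apply {f g : Coeffs} (hf : ∀ k, f (-k) = conj (f k))
    (hg : ∀ k, g (-k) = conj (g k)) (k : Fin 2 → ℤ) :
    transport f g (-k) = conj (transport f g k) := by
  rw [transport, transport, Complex.conj_tsum, ← (Equiv.neg (Fin 2 → ℤ)).tsum_eq]
  refine tsum_congr fun j => ?_
  rw [Equiv.neg_apply, transportSymbol_neg_neg, hf, show -k - -j = -(k - j) by abel, hg]
  simp

section Estimates

variable {f g : Coeffs}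

theorem norm_transport_summand_le (f g : Coeffs) (k j : Fin 2 → ℤ) :
    ‖(transportSymbol k j : ℂ) * (f j * g (k - j))‖ ≤
      ‖waveVector k‖ * (‖f j‖ * ‖g (k - j)‖) := by
  rw [norm_mul, norm_mul, Complex.norm_real, Real.norm_eq_abs]
  gcongr
  exact abs_transportSymbol_le k j

theorem convolution_bound (hf0 : f 0 = 0) (hg0 : g 0 = 0)
    (hf : Summable fun k => (‖waveVector k‖ * ‖f k‖) ^ 2)
    (hg : Summable fun k => (‖waveVector k‖ * ‖g k‖) ^ 2) :
    (∀ k, Summable fun j => ‖f j‖ * ‖g (k - j)‖) ∧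
    (Summable fun k => (∑' j, ‖f j‖ * ‖g (k - j)‖) ^ 2) := by
  have h := weightedConvolution_bound (p := 0) (q := 0) hf0 hg0 (by simpa using hf)
    (by simpa using hg)
  simp only [pow_zero, one_mul] at h
  exact ⟨h.1, h.2.1⟩

theorem summable_transport (hf0 : f 0 = 0) (hg0 : g 0 = 0)
    (hf : Summable fun k => (‖waveVector k‖ * ‖f k‖) ^ 2)
    (hg : Summable fun k => (‖waveVector k‖ * ‖g k‖) ^ 2) (k : Fin 2 → ℤ) :
    Summable fun j => (transportSymbol k j : ℂ) * (f j * g (k - j)) :=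
  .of_norm_bounded (((convolution_bound hf0 hg0 hf hg).1 k).mul_left ‖waveVector k‖)
    (norm_transport_summand_le f g k)

theorem norm_transport_le (hf0 : f 0 = 0) (hg0 : g 0 = 0)
    (hf : Summable fun k => (‖waveVector k‖ * ‖f k‖) ^ 2)
    (hg : Summable fun k => (‖waveVector k‖ * ‖g k‖) ^ 2) (k : Fin 2 → ℤ) :
    ‖transport f g k‖ ≤ ‖waveVector k‖ * ∑' j, ‖f j‖ * ‖g (k - j)‖ := by
  rw [← tsum_mul_left]
  exact tsum_of_norm_bounded (((convolution_bound hf0 hg0 hf hg).1 k).mul_left _).hasSum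
    (norm_transport_summand_le f g k)

/-- The cancellation `∫ div (v f) f = 0`, which is the conservation of energy: in frequency the
triple sum changes sign under the involution `(k, j) ↦ (j - k, j)`. -/
theorem tsum_conj_mul_transport_eq_zero (hf0 : f 0 = 0) (hconj : ∀ k, f (-k) = conj (f k))
    (hf : Summable fun k => (‖waveVector k‖ * ‖f k‖) ^ 2) :
    ∑' k, conj (f k) * transport f f k = 0 := by
  obtain ⟨hc1, hc2⟩ := convolution_bound hf0 hf0 hf hf
  -- `Φ (k, j)` is the summand; `conj (f k) = f (-k)` makes it a trilinear expression in `f`.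
  let Φ : (Fin 2 → ℤ) × (Fin 2 → ℤ) → ℂ := fun p =>
    conj (f p.1) * ((transportSymbol p.1 p.2 : ℂ) * (f p.2 * f (p.1 - p.2)))
  have hbound : Summable fun p : (Fin 2 → ℤ) × (Fin 2 → ℤ) =>
      ‖waveVector p.1‖ * ‖f p.1‖ * (‖f p.2‖ * ‖f (p.1 - p.2)‖) := by
    have hnonneg : ∀ p : (Fin 2 → ℤ) × (Fin 2 → ℤ),
        0 ≤ ‖waveVector p.1‖ * ‖f p.1‖ * (‖f p.2‖ * ‖f (p.1 - p.2)‖) := fun p => by positivity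
    have hfiber : ∀ k, Summable fun j =>
        ‖waveVector k‖ * ‖f k‖ * (‖f j‖ * ‖f (k - j)‖) := fun k =>
      (hc1 k).mul_left (‖waveVector k‖ * ‖f k‖)
    have hout : Summable fun k => ‖waveVector k‖ * ‖f k‖ * ∑' j, ‖f j‖ * ‖f (k - j)‖ :=
      (summable_mul_and_sq_tsum_le (x := fun k => ‖waveVector k‖ * ‖f k‖)
        (y := fun k => ∑' j, ‖f j‖ * ‖f (k - j)‖)
        (fun k => by positivity) (fun k => tsum_nonneg fun j => by positivity) hf hc2).1
    refine (summable_prod_of_nonneg hnonneg).2 ⟨hfiber, hout.congr fun k => ?_⟩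
    exact tsum_mul_left.symm
  have hΦ : Summable Φ := by
    refine .of_norm_bounded hbound fun p => ?_
    have h := norm_transport_summand_le f f p.1 p.2
    calc ‖Φ p‖ = ‖f p.1‖ * ‖(transportSymbol p.1 p.2 : ℂ) * (f p.2 * f (p.1 - p.2))‖ := by
          rw [norm_mul, RCLike.norm_conj]
      _ ≤ ‖f p.1‖ * (‖waveVector p.1‖ * (‖f p.2‖ * ‖f (p.1 - p.2)‖)) := by gcongr
      _ = _ := by ring
  have hinv : Function.Involutive
      fun p : (Fin 2 → ℤ) × (Fin 2 → ℤ) => (p.2 - p.1, p.2) := fun p => by simp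
  have hanti : ∀ p, Φ (hinv.toPerm _ p) = -Φ p := by
    rintro ⟨k, j⟩
    change conj (f (j - k)) * ((transportSymbol (j - k) j : ℂ) * (f j * f (j - k - j))) =
      -(conj (f k) * ((transportSymbol k j : ℂ) * (f j * f (k - j))))
    rw [transportSymbol_sub_left, show j - k - j = -k by abel, ← hconj, neg_sub, hconj k]
    push_cast
    ring
  have hzero : ∑' p, Φ p = 0 := by
    have h := (hinv.toPerm _).tsum_eq Φ
    simp only [hanti, tsum_neg] at h
    exact self_eq_neg.1 h.symm
  rw [hΦ.tsum_prod] at hzero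
  rw [← hzero]
  exact tsum_congr fun k => tsum_mul_left.symm

end Estimates

/-- The weight of `Ḣ^{n+1}` at the output frequency `k`, multiplied by the symbol bound for
`(1 - α² Δ)⁻¹ div`, is distributed over the input frequencies `j` and `k - j`. -/
theorem pow_mul_inv_helmholtzSymbol_le {α : ℝ} (hα : 0 < α) (n : ℕ) (j k : Fin 2 → ℤ) :
    ‖waveVector k‖ ^ (n + 1) * (helmholtzSymbol α k)⁻¹ * ‖waveVector k‖ ≤
      2 ^ n / α ^ 2 * (‖waveVector j‖ ^ n + ‖waveVector (k - j)‖ ^ n) := by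
  have h1 : ‖waveVector k‖ ^ 2 * (helmholtzSymbol α k)⁻¹ ≤ 1 / α ^ 2 := by
    rw [← div_eq_mul_inv, div_le_div_iff₀ (helmholtzSymbol_pos α k) (by positivity)]
    unfold helmholtzSymbol
    linarith
  have h2 : ‖waveVector k‖ ^ n ≤
      2 ^ n * (‖waveVector j‖ ^ n + ‖waveVector (k - j)‖ ^ n) := by
    have hle : ‖waveVector k‖ ≤ ‖waveVector j‖ + ‖waveVector (k - j)‖ := by
      rw [waveVector_sub]
      exact norm_le_norm_add_norm_sub' _ _
    calc ‖waveVector k‖ ^ n ≤ (‖waveVector j‖ + ‖waveVector (k - j)‖) ^ n := by gcongr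
      _ ≤ 2 ^ (n - 1) * (‖waveVector j‖ ^ n + ‖waveVector (k - j)‖ ^ n) :=
        add_pow_le (norm_nonneg _) (norm_nonneg _) n
      _ ≤ _ := by
        gcongr
        · norm_num
        · exact Nat.sub_le n 1
  calc _ = (‖waveVector k‖ ^ 2 * (helmholtzSymbol α k)⁻¹) * ‖waveVector k‖ ^ n := by ring
    _ ≤ 1 / α ^ 2 * (2 ^ n * (‖waveVector j‖ ^ n + ‖waveVector (k - j)‖ ^ n)) :=
      mul_le_mul h1 h2 (by positivity) (by positivity)
    _ = _ := by ring

/-- The constant in the estimates for `regTransport` in `Ḣ^{n+1}`. -/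
noncomputable def transportConst (α : ℝ) (n : ℕ) : ℝ := 2 * (2 ^ n / α ^ 2) ^ 2 * latticeSum

theorem transportConst_nonneg (α : ℝ) (n : ℕ) : 0 ≤ transportConst α n := by
  have := latticeSum_nonneg
  unfold transportConst
  positivity

/-- The tame estimate for the nonlinearity in `Ḣ^{n+1}`: the `n + 1` derivatives fall on one factor
only, the other one is measured in `Ḣ¹`. -/
theorem regTransport_bound {α : ℝ} (hα : 0 < α) (n : ℕ) {f g : Coeffs} (hf0 : f 0 = 0)
    (hg0 : g 0 = 0) (hf : Summable fun k => (‖waveVector k‖ * ‖f k‖) ^ 2)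
    (hg : Summable fun k => (‖waveVector k‖ * ‖g k‖) ^ 2)
    (hfn : Summable fun k => (‖waveVector k‖ ^ (n + 1) * ‖f k‖) ^ 2)
    (hgn : Summable fun k => (‖waveVector k‖ ^ (n + 1) * ‖g k‖) ^ 2) :
    (Summable fun k => (‖waveVector k‖ ^ (n + 1) * ‖regTransport α f g k‖) ^ 2) ∧
    sobolevSq (n + 1) (regTransport α f g) ≤ transportConst α n *
      (sobolevSq (n + 1) f * sobolevSq 1 g + sobolevSq 1 f * sobolevSq (n + 1) g) := by
  obtain ⟨a1, a2, a3⟩ := weightedConvolution_bound (p := n) (q := 0) hf0 hg0 hfn (by simpa using hg)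
  obtain ⟨b1, b2, b3⟩ := weightedConvolution_bound (p := 0) (q := n) hf0 hg0 (by simpa using hf) hgn
  simp only [pow_zero, one_mul, zero_add] at a1 a2 a3 b1 b2 b3
  set A : (Fin 2 → ℤ) → ℝ := fun k => ∑' j, ‖waveVector j‖ ^ n * ‖f j‖ * ‖g (k - j)‖
  set B : (Fin 2 → ℤ) → ℝ := fun k => ∑' j, ‖f j‖ * (‖waveVector (k - j)‖ ^ n * ‖g (k - j)‖)
  have hpt : ∀ k, ‖waveVector k‖ ^ (n + 1) * ‖regTransport α f g k‖ ≤
      2 ^ n / α ^ 2 * (A k + B k) := by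
    intro k
    have hH := helmholtzSymbol_pos α k
    have hc := (convolution_bound hf0 hg0 hf hg).1 k
    have hreg : ‖regTransport α f g k‖ = (helmholtzSymbol α k)⁻¹ * ‖transport f g k‖ := by
      rw [regTransport, norm_mul, ← Complex.ofReal_inv, Complex.norm_real,
        Real.norm_of_nonneg (by positivity)]
    calc ‖waveVector k‖ ^ (n + 1) * ‖regTransport α f g k‖
        ≤ ‖waveVector k‖ ^ (n + 1) * ((helmholtzSymbol α k)⁻¹ *
            (‖waveVector k‖ * ∑' j, ‖f j‖ * ‖g (k - j)‖)) := by
          rw [hreg]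
          gcongr
          exact norm_transport_le hf0 hg0 hf hg k
      _ = ∑' j, (‖waveVector k‖ ^ (n + 1) * (helmholtzSymbol α k)⁻¹ * ‖waveVector k‖) *
            (‖f j‖ * ‖g (k - j)‖) := by
          rw [tsum_mul_left]
          ring
      _ ≤ ∑' j, 2 ^ n / α ^ 2 * (‖waveVector j‖ ^ n * ‖f j‖ * ‖g (k - j)‖ +
            ‖f j‖ * (‖waveVector (k - j)‖ ^ n * ‖g (k - j)‖)) := by
          refine (hc.mul_left _).tsum_le_tsum (fun j => ?_) (((a1 k).add (b1 k)).mul_left _)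
          refine (mul_le_mul_of_nonneg_right (pow_mul_inv_helmholtzSymbol_le hα n j k)
            (by positivity)).trans_eq ?_
          ring
      _ = 2 ^ n / α ^ 2 * (A k + B k) := by
          rw [tsum_mul_left, (a1 k).tsum_add (b1 k)]
  have hle : ∀ k, (‖waveVector k‖ ^ (n + 1) * ‖regTransport α f g k‖) ^ 2 ≤
      2 * (2 ^ n / α ^ 2) ^ 2 * (A k ^ 2 + B k ^ 2) := by
    intro k
    calc _ ≤ (2 ^ n / α ^ 2 * (A k + B k)) ^ 2 := pow_le_pow_left₀ (by positivity) (hpt k) 2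
      _ = (2 ^ n / α ^ 2) ^ 2 * (A k + B k) ^ 2 := by ring
      _ ≤ (2 ^ n / α ^ 2) ^ 2 * (2 * (A k ^ 2 + B k ^ 2)) := by
        gcongr
        exact add_sq_le
      _ = _ := by ring
  have hmaj := (a2.add b2).mul_left (2 * (2 ^ n / α ^ 2) ^ 2)
  have hs := Summable.of_nonneg_of_le (fun k => sq_nonneg _) hle hmaj
  refine ⟨hs, (hs.tsum_le_tsum hle hmaj).trans ?_⟩
  rw [tsum_mul_left, a2.tsum_add b2]
  calc _ ≤ 2 * (2 ^ n / α ^ 2) ^ 2 * (latticeSum * (sobolevSq (n + 1) f * sobolevSq 1 g) +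
        latticeSum * (sobolevSq 1 f * sobolevSq (n + 1) g)) := by gcongr
    _ = _ := by
      unfold transportConst
      ring

namespace Hdot

theorem summable_of_succ {n : ℕ} (c : Hdot (n + 1 : ℕ)) :
    (Summable fun k => (‖waveVector k‖ * ‖c.coeffs k‖) ^ 2) ∧
      Summable fun k => (‖waveVector k‖ ^ (n + 1) * ‖c.coeffs k‖) ^ 2 := by
  refine ⟨?_, by simpa only [zpow_natCast] using c.summable_coeffs⟩
  have h : (1 : ℤ) ≤ (n + 1 : ℕ) := by push_cast; linarith
  simpa using (inclusion h c).summable_coeffs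

theorem regTransport_mem {α : ℝ} (hα : 0 < α) {n : ℕ} (f g : Hdot (n + 1 : ℕ)) :
    regTransport α f.coeffs g.coeffs ∈ hdotSubmodule (n + 1 : ℕ) := by
  refine mem_hdotSubmodule_iff.2 ⟨by simp [regTransport, transport_zero_apply], fun k => ?_, ?_⟩
  · rw [regTransport, regTransport, transport_neg_apply f.coeffs_neg_apply g.coeffs_neg_apply,
      helmholtzSymbol_neg]
    simp
  · simpa only [zpow_natCast] using (regTransport_bound hα n f.coeffs_zero_apply g.coeffs_zero_apply
      f.summable_of_succ.1 g.summable_of_succ.1 f.summable_of_succ.2 g.summable_of_succ.2).1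

theorem sobolevSq_one_eq {n : ℕ} (c : Hdot (n + 1 : ℕ)) (h : (1 : ℤ) ≤ (n + 1 : ℕ)) :
    sobolevSq 1 c.coeffs = ‖inclusion h c‖ ^ 2 := by
  simp [norm_sq_eq, sobolevSq]

/-- The nonlinearity `(f, g) ↦ -(1 - α² Δ)⁻¹ div (∇^⊥ (-Δ)^{-1/2} f · g)` as a bounded bilinear map
on `Ḣ^{n+1}`. -/
noncomputable def nonlinearity {α : ℝ} (hα : 0 < α) (n : ℕ) :
    Hdot (n + 1 : ℕ) →L[ℝ] Hdot (n + 1 : ℕ) →L[ℝ] Hdot (n + 1 : ℕ) :=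
  LinearMap.mkContinuous₂
    (LinearMap.mk₂ ℝ (fun f g => mk (regTransport α f.coeffs g.coeffs) (regTransport_mem hα f g))
      (fun f f' g => by
        ext k
        simp only [coeffs_mk, coeffs_add, Pi.add_apply, regTransport, transport, add_mul, mul_add]
        rw [Summable.tsum_add, mul_add]
        · exact summable_transport f.coeffs_zero_apply g.coeffs_zero_apply f.summable_of_succ.1
            g.summable_of_succ.1 k
        · exact summable_transport f'.coeffs_zero_apply g.coeffs_zero_apply f'.summable_of_succ.1
            g.summable_of_succ.1 k)
      (fun a f g => by
        ext k
        simp only [coeffs_mk, coeffs_smul, Pi.smul_apply, regTransport, transport,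
          smul_mul_assoc, mul_smul_comm]
        rw [tsum_const_smul'', mul_smul_comm])
      (fun f g g' => by
        ext k
        simp only [coeffs_mk, coeffs_add, Pi.add_apply, regTransport, transport, mul_add]
        rw [Summable.tsum_add, mul_add]
        · exact summable_transport f.coeffs_zero_apply g.coeffs_zero_apply f.summable_of_succ.1
            g.summable_of_succ.1 k
        · exact summable_transport f.coeffs_zero_apply g'.coeffs_zero_apply f.summable_of_succ.1
            g'.summable_of_succ.1 k)
      (fun a f g => by
        ext k
        simp only [coeffs_mk, coeffs_smul, Pi.smul_apply, regTransport, transport,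
          mul_smul_comm]
        rw [tsum_const_smul'', mul_smul_comm]))
    √(2 * transportConst α n) fun f g => by
      have h1 : (1 : ℤ) ≤ (n + 1 : ℕ) := by push_cast; linarith
      have hb := (regTransport_bound hα n f.coeffs_zero_apply g.coeffs_zero_apply
        f.summable_of_succ.1 g.summable_of_succ.1 f.summable_of_succ.2 g.summable_of_succ.2).2
      rw [sobolevSq_eq f, sobolevSq_eq g, sobolevSq_one_eq f h1, sobolevSq_one_eq g h1] at hb
      refine (sq_le_sq₀ (norm_nonneg _) (by positivity)).1 ?_
      have hC := transportConst_nonneg α n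
      rw [← sobolevSq_eq, mul_pow, mul_pow, Real.sq_sqrt (by positivity)]
      refine hb.trans ?_
      calc _ ≤ transportConst α n * (‖f‖ ^ 2 * ‖g‖ ^ 2 + ‖f‖ ^ 2 * ‖g‖ ^ 2) := by
            gcongr <;> exact norm_inclusion_le _ _
        _ = _ := by ring

@[simp]
theorem coeffs_nonlinearity {α : ℝ} (hα : 0 < α) {n : ℕ} (f g : Hdot (n + 1 : ℕ)) :
    (nonlinearity hα n f g).coeffs = regTransport α f.coeffs g.coeffs := rfl

/-- The nonlinearity grows at most linearly in `Ḣ^{n+1}` on bounded subsets of `Ḣ¹`. -/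
theorem norm_nonlinearity_self_le {α : ℝ} (hα : 0 < α) {n : ℕ} (h : (1 : ℤ) ≤ (n + 1 : ℕ))
    (f : Hdot (n + 1 : ℕ)) :
    ‖nonlinearity hα n f f‖ ≤ √(2 * transportConst α n) * ‖inclusion h f‖ * ‖f‖ := by
  have hC := transportConst_nonneg α n
  have hb := (regTransport_bound hα n f.coeffs_zero_apply f.coeffs_zero_apply
    f.summable_of_succ.1 f.summable_of_succ.1 f.summable_of_succ.2 f.summable_of_succ.2).2
  rw [sobolevSq_eq f, sobolevSq_one_eq f h] at hb
  refine (sq_le_sq₀ (norm_nonneg _) (by positivity)).1 ?_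
  rw [← sobolevSq_eq, mul_pow, mul_pow, Real.sq_sqrt (by positivity)]
  refine hb.trans_eq ?_
  ring

/-- The map `f ↦ (1 - α² Δ)^{1/2} f` into `ℓ²`; the square of its norm is the conserved energy
`‖f‖² + α² ‖∇f‖²`. -/
noncomputable def energyMap (α : ℝ) (n : ℕ) :
    Hdot (n + 1 : ℕ) →L[ℝ] lp (fun _ : Fin 2 → ℤ => ℂ) 2 :=
  (toEll2Isometry 0).toContinuousLinearMap.comp
    (multiplier (n + 1 : ℕ) 0 (fun k => √(helmholtzSymbol α k))
      (fun k => by rw [helmholtzSymbol_neg]) (1 + |α|) fun k hk => by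
        have h1 := one_le_norm_waveVector hk
        have h2 : √(helmholtzSymbol α k) ≤ (1 + |α|) * ‖waveVector k‖ := by
          refine Real.sqrt_le_iff.2 ⟨by positivity, ?_⟩
          rw [helmholtzSymbol, mul_pow, add_sq, one_pow, sq_abs]
          have : (1 : ℝ) ≤ ‖waveVector k‖ ^ 2 := one_le_pow₀ h1
          nlinarith [abs_nonneg α, mul_nonneg (abs_nonneg α) (sq_nonneg ‖waveVector k‖)]
        rw [zpow_zero, one_mul, abs_of_nonneg (Real.sqrt_nonneg _), zpow_natCast]
        refine h2.trans ?_
        gcongr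
        exact le_self_pow₀ h1 (by simp))

theorem energyMap_apply (α : ℝ) {n : ℕ} (f : Hdot (n + 1 : ℕ)) (k : Fin 2 → ℤ) :
    energyMap α n f k = (√(helmholtzSymbol α k) : ℂ) * f.coeffs k := by
  change ((‖waveVector k‖ ^ (0 : ℤ) : ℝ) : ℂ) * ((√(helmholtzSymbol α k) : ℂ) * f.coeffs k) = _
  simp

theorem norm_inclusion_one_le_energyMap {α : ℝ} (hα : 0 < α) {n : ℕ} (h : (1 : ℤ) ≤ (n + 1 : ℕ))
    (f : Hdot (n + 1 : ℕ)) : ‖inclusion h f‖ ≤ α⁻¹ * ‖energyMap α n f‖ := by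
  refine (sq_le_sq₀ (norm_nonneg _) (by positivity)).1 ?_
  have hE := lp.norm_rpow_eq_tsum (p := 2) (by simp) (energyMap α n f)
  have hEs := memlp_two_iff.1 (lp.memℓp (energyMap α n f))
  simp only [ENNReal.toReal_ofNat, Real.rpow_two] at hE
  rw [mul_pow, hE, norm_sq_eq, ← tsum_mul_left]
  refine (inclusion h f).summable_coeffs.tsum_le_tsum (fun k => ?_) (hEs.mul_left _)
  rw [energyMap_apply, norm_mul, Complex.norm_real, Real.norm_of_nonneg (Real.sqrt_nonneg _),
    mul_pow, mul_pow, Real.sq_sqrt (helmholtzSymbol_pos α k).le, coeffs_inclusion, zpow_one,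
    ← mul_assoc]
  gcongr
  rw [helmholtzSymbol, mul_add, inv_pow, inv_mul_cancel_left₀ (by positivity)]
  linarith [inv_nonneg.2 (sq_nonneg α)]

theorem inner_energyMap_nonlinearity {α : ℝ} (hα : 0 < α) {n : ℕ} (f : Hdot (n + 1 : ℕ)) :
    inner ℂ (energyMap α n f) (energyMap α n (nonlinearity hα n f f)) = 0 := by
  rw [lp.inner_eq_tsum, ← tsum_conj_mul_transport_eq_zero f.coeffs_zero_apply f.coeffs_neg_apply
    f.summable_of_succ.1]
  refine tsum_congr fun k => ?_
  have hne : (helmholtzSymbol α k : ℂ) ≠ 0 := Complex.ofReal_ne_zero.2 (helmholtzSymbol_pos α k).ne'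
  have hsq : (√(helmholtzSymbol α k) : ℂ) * (√(helmholtzSymbol α k) : ℂ) = helmholtzSymbol α k := by
    rw [← Complex.ofReal_mul, Real.mul_self_sqrt (helmholtzSymbol_pos α k).le]
  rw [energyMap_apply, energyMap_apply, coeffs_nonlinearity, regTransport, RCLike.inner_apply,
    map_mul, Complex.conj_ofReal]
  calc _ = ((√(helmholtzSymbol α k) : ℂ) * (√(helmholtzSymbol α k) : ℂ)) *
        ((helmholtzSymbol α k : ℂ)⁻¹ * (conj (f.coeffs k) * transport f.coeffs f.coeffs k)) := by
          ring
    _ = _ := by rw [hsq, mul_inv_cancel_left₀ hne]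

/-- Conservation of energy. -/
theorem norm_energyMap_eq {α : ℝ} (hα : 0 < α) {n : ℕ} {u : ℝ → Hdot (n + 1 : ℕ)} {a : ℝ}
    (hu : SolvesOn (fun f => nonlinearity hα n f f) u (-a) a) {t : ℝ} (ht : t ∈ Set.Ioo (-a) a) :
    ‖energyMap α n (u t)‖ = ‖energyMap α n (u 0)‖ := by
  have hd : ∀ s ∈ Set.Ioo (-a) a,
      HasDerivAt (fun s => inner ℂ (energyMap α n (u s)) (energyMap α n (u s))) 0 s := by
    intro s hs
    have h1 := (energyMap α n).hasFDerivAt.comp_hasDerivAt s (hu s hs)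
    have h2 := h1.inner ℂ h1
    rw [Function.comp_apply, inner_energyMap_nonlinearity,
      inner_eq_zero_symm.1 (inner_energyMap_nonlinearity hα (u s)), add_zero] at h2
    exact h2
  have hconst := isOpen_Ioo.is_const_of_deriv_eq_zero isPreconnected_Ioo
    (fun s hs => (hd s hs).differentiableAt.differentiableWithinAt) (fun s hs => (hd s hs).deriv)
    ht (show (0 : ℝ) ∈ Set.Ioo (-a) a from ⟨by linarith [ht.1, ht.2], by linarith [ht.1, ht.2]⟩)
  simp only [inner_self_eq_norm_sq_to_K] at hconst
  have h3 : ‖energyMap α n (u t)‖ ^ 2 = ‖energyMap α n (u 0)‖ ^ 2 := by exact_mod_cast hconst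
  exact (pow_left_inj₀ (norm_nonneg _) (norm_nonneg _) two_ne_zero).1 h3

theorem exists_lipschitzOnWith_nonlinearity {α : ℝ} (hα : 0 < α) (n : ℕ) (R : ℝ) :
    ∃ K : NNReal, LipschitzOnWith K (fun f => nonlinearity hα n f f) (Metric.closedBall 0 R) := by
  refine ⟨‖nonlinearity hα n‖₊ * (2 * R.toNNReal), LipschitzOnWith.of_dist_le_mul ?_⟩
  intro f hf g hg
  rw [mem_closedBall_zero_iff] at hf hg
  have hR : 0 ≤ R := (norm_nonneg f).trans hf
  rw [dist_eq_norm, dist_eq_norm]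
  have e : nonlinearity hα n f f - nonlinearity hα n g g =
      nonlinearity hα n (f - g) f + nonlinearity hα n g (f - g) := by
    simp
  rw [e]
  have h1 := (nonlinearity hα n).le_opNorm₂ (f - g) f
  have h2 := (nonlinearity hα n).le_opNorm₂ g (f - g)
  push_cast
  rw [Real.coe_toNNReal R hR]
  calc _ ≤ ‖nonlinearity hα n‖ * ‖f - g‖ * ‖f‖ + ‖nonlinearity hα n‖ * ‖g‖ * ‖f - g‖ :=
        (norm_add_le _ _).trans (add_le_add h1 h2)
    _ ≤ ‖nonlinearity hα n‖ * ‖f - g‖ * R + ‖nonlinearity hα n‖ * R * ‖f - g‖ := by gcongr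
    _ = _ := by ring

/-- Global existence in `Ḣ^{n+1}`. Conservation of energy bounds the `Ḣ¹` norm for all times, and
by the tame estimate the `Ḣ^{n+1}` norm grows at most exponentially. -/
theorem exists_global_solution {α : ℝ} (hα : 0 < α) (n : ℕ) (f₀ : Hdot (n + 1 : ℕ)) :
    ∃ u : ℝ → Hdot (n + 1 : ℕ), u 0 = f₀ ∧ ∀ t, HasDerivAt u (nonlinearity hα n (u t) (u t)) t := by
  refine _root_.exists_global_solution (F := fun f => nonlinearity hα n f f)
    (exists_lipschitzOnWith_nonlinearity hα n) f₀ fun T => ?_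
  have h1 : (1 : ℤ) ≤ (n + 1 : ℕ) := by push_cast; linarith
  set C := √(2 * transportConst α n) * (α⁻¹ * ‖energyMap α n f₀‖) with hC
  refine ⟨‖f₀‖ * Real.exp (C * T), fun a haT u hu0 hu t ht => ?_⟩
  have hgrow := norm_le_mul_exp_of_norm_deriv_le (C := C) hu (fun s hs => by
    refine (norm_nonlinearity_self_le hα h1 (u s)).trans ?_
    rw [hC, ← hu0, ← norm_energyMap_eq hα hu hs]
    gcongr
    exact norm_inclusion_one_le_energyMap hα h1 (u s)) ht
  rw [hu0] at hgrow
  refine hgrow.trans ?_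
  gcongr
  exact (abs_lt.2 ht).le.trans haT

theorem eq_of_hasDerivAt {α : ℝ} (hα : 0 < α) {n : ℕ} {u w : ℝ → Hdot (n + 1 : ℕ)}
    (hu : ∀ t, HasDerivAt u (nonlinearity hα n (u t) (u t)) t)
    (hw : ∀ t, HasDerivAt w (nonlinearity hα n (w t) (w t)) t) (h : u 0 = w 0) : u = w := by
  funext t
  have ht : t ∈ Set.Ioo (-(|t| + 1)) (|t| + 1) := abs_lt.1 (lt_add_one _)
  exact SolvesOn.eqOn (F := fun f => nonlinearity hα n f f)
    (exists_lipschitzOnWith_nonlinearity hα n) (fun s _ => hu s) (fun s _ => hw s) (t₀ := 0)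
    ⟨by linarith [abs_nonneg t], by positivity⟩ h ht

end Hdot

/-! ### Fourier coefficients of square integrable functions -/

/-- The Fourier basis of the complex `L²` space of the periodic square. -/
noncomputable def fourierBasis : HilbertBasis (Fin 2 → ℤ) ℂ (Lp ℂ 2 torusMeasure) :=
  UnitAddTorus.mFourierBasis

theorem fourierBasis_ae (k : Fin 2 → ℤ) :
    fourierBasis k =ᵐ[torusMeasure] UnitAddTorus.mFourier k := by
  have h : (fourierBasis k : Lp ℂ 2 torusMeasure) = UnitAddTorus.mFourierLp 2 k :=
    congrFun UnitAddTorus.coe_mFourierBasis k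
  rw [h]
  exact UnitAddTorus.coeFn_mFourierLp 2 k

theorem fourierBasis_repr (F : Lp ℂ 2 torusMeasure) (k : Fin 2 → ℤ) :
    fourierBasis.repr F k = ∫ x, UnitAddTorus.mFourier (-k) x * F x ∂torusMeasure :=
  UnitAddTorus.mFourierBasis_repr F k

/-- A real-valued square integrable function, regarded as a complex-valued one. -/
noncomputable def complexify (u : L2) : Lp ℂ 2 torusMeasure := Complex.ofRealCLM.compLp u

theorem complexify_ae (u : L2) : complexify u =ᵐ[torusMeasure] fun x => (u x : ℂ) :=
  Complex.ofRealCLM.coeFn_compLp u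

theorem fourierBasis_repr_complexify (u : L2) (k : Fin 2 → ℤ) :
    fourierBasis.repr (complexify u) k = fourierCoeffs u k := by
  rw [fourierBasis_repr]
  refine integral_congr_ae ?_
  filter_upwards [complexify_ae u] with x hx
  rw [hx]

theorem fourierCoeffs_injective {u w : L2} (h : fourierCoeffs u = fourierCoeffs w) : u = w := by
  have hc : complexify u = complexify w := by
    apply fourierBasis.repr.injective
    ext k
    rw [fourierBasis_repr_complexify, fourierBasis_repr_complexify, h]
  refine Lp.ext ?_
  filter_upwards [complexify_ae u, complexify_ae w] with x hu hw
  rw [hc, hw] at hu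
  exact_mod_cast hu.symm

theorem fourierCoeffs_neg (u : Torus → ℝ) (k : Fin 2 → ℤ) :
    fourierCoeffs u (-k) = conj (fourierCoeffs u k) := by
  rw [fourierCoeffs, fourierCoeffs, ← integral_conj]
  simp [UnitAddTorus.mFourier_neg]

theorem fourierCoeffs_zero (u : Torus → ℝ) :
    fourierCoeffs u 0 = ((∫ x, u x ∂torusMeasure : ℝ) : ℂ) := by
  rw [← integral_complex_ofReal]
  simp [fourierCoeffs, UnitAddTorus.mFourier_zero]

theorem fourierCoeffs_zero_eq_zero_iff (u : Torus → ℝ) :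
    fourierCoeffs u 0 = 0 ↔ ∫ x, u x ∂torusMeasure = 0 := by
  rw [fourierCoeffs_zero, Complex.ofReal_eq_zero]

theorem memLp_mFourier_mul (k : Fin 2 → ℤ) {F : Torus → ℂ} (hF : MemLp F 2 torusMeasure) :
    MemLp (fun x => UnitAddTorus.mFourier k x * F x) 2 torusMeasure := by
  refine hF.of_le ((UnitAddTorus.mFourier k).continuous.aestronglyMeasurable.mul
    hF.aestronglyMeasurable) (.of_forall fun x => ?_)
  have h := (UnitAddTorus.mFourier k).norm_coe_le_norm x
  rw [UnitAddTorus.mFourier_norm] at h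
  rw [norm_mul]
  exact mul_le_of_le_one_left (norm_nonneg _) h

theorem integrable_mFourier_mul (k : Fin 2 → ℤ) (F : Lp ℂ 2 torusMeasure) :
    Integrable (fun x => UnitAddTorus.mFourier k x * F x) torusMeasure :=
  (memLp_mFourier_mul k (Lp.memLp F)).integrable (by norm_num)

/-- The Riesz–Fischer theorem for real-valued functions. -/
theorem exists_fourierCoeffs_eq {c : Coeffs} (hconj : ∀ k, c (-k) = conj (c k))
    (hc : Summable fun k => ‖c k‖ ^ 2) : ∃ u : L2, fourierCoeffs u = c := by
  let F : Lp ℂ 2 torusMeasure := fourierBasis.repr.symm ⟨c, memlp_two_iff.2 hc⟩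
  have hF : ∀ k, ∫ x, UnitAddTorus.mFourier (-k) x * F x ∂torusMeasure = c k := by
    intro k
    rw [← fourierBasis_repr]
    simp [F]
  refine ⟨Complex.reCLM.compLp F, ?_⟩
  funext k
  have hre : ∀ᵐ x ∂torusMeasure,
      UnitAddTorus.mFourier (-k) x * ((Complex.reCLM.compLp F) x : ℂ) =
        2⁻¹ * (UnitAddTorus.mFourier (-k) x * F x) +
          2⁻¹ * conj (UnitAddTorus.mFourier (- -k) x * F x) := by
    filter_upwards [Complex.reCLM.coeFn_compLp F] with x hx
    rw [hx, Complex.reCLM_apply, Complex.re_eq_add_conj, UnitAddTorus.mFourier_neg (n := -k),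
      map_mul, Complex.conj_conj]
    ring
  have hint : Integrable (fun x => conj (UnitAddTorus.mFourier (- -k) x * F x)) torusMeasure :=
    Complex.conjLIE.toContinuousLinearEquiv.toContinuousLinearMap.integrable_comp
      (integrable_mFourier_mul _ F)
  rw [fourierCoeffs, integral_congr_ae hre,
    integral_add ((integrable_mFourier_mul _ F).const_mul _) (hint.const_mul _),
    integral_const_mul, integral_const_mul, integral_conj, hF, hF, hconj, Complex.conj_conj]
  ring

/-- The Fourier coefficients of a product are the convolution of those of its factors. -/
theorem hasSum_fourierCoeffs_mul (u w : L2) (k : Fin 2 → ℤ) :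
    HasSum (fun j => fourierCoeffs u j * fourierCoeffs w (k - j))
      (fourierCoeffs (fun x => u x * w x) k) := by
  have hmem := memLp_mFourier_mul k (Lp.memLp (complexify w))
  -- Parseval's identity for `F = exp (2πi k·x) w` and `u`.
  let F : Lp ℂ 2 torusMeasure := hmem.toLp _
  have hF : F =ᵐ[torusMeasure] fun x => UnitAddTorus.mFourier k x * (w x : ℂ) := by
    filter_upwards [hmem.coeFn_toLp, complexify_ae w] with x h1 h2
    rw [h1, h2]
  have h := fourierBasis.hasSum_inner_mul_inner F (complexify u)
  have hinner : inner ℂ F (complexify u) = fourierCoeffs (fun x => u x * w x) k := by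
    rw [L2.inner_def]
    refine integral_congr_ae ?_
    filter_upwards [hF, complexify_ae u] with x h1 h2
    rw [h1, h2, RCLike.inner_apply, map_mul, ← UnitAddTorus.mFourier_neg, Complex.conj_ofReal]
    push_cast
    ring
  rw [hinner] at h
  refine h.congr_fun fun j => ?_
  rw [← fourierBasis.repr_apply_apply, fourierBasis_repr_complexify, mul_comm]
  congr 1
  rw [L2.inner_def]
  refine integral_congr_ae ?_
  filter_upwards [hF, fourierBasis_ae j] with x h1 h2
  rw [h1, h2, RCLike.inner_apply, map_mul, ← UnitAddTorus.mFourier_neg, Complex.conj_ofReal,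
    neg_sub, sub_eq_add_neg, UnitAddTorus.mFourier_add]
  ring

/-! ### The regularized equation in Fourier variables -/

theorem helmholtz_apply (α : ℝ) (c : Coeffs) (k : Fin 2 → ℤ) :
    helmholtz α c k = helmholtzSymbol α k * c k := by
  simp only [helmholtz, laplacian, partialDeriv, Fin.sum_univ_two, Pi.sub_apply, Pi.smul_apply,
    Pi.add_apply, helmholtzSymbol, norm_waveVector_sq, smul_eq_mul]
  push_cast
  linear_combination (-(α : ℂ) ^ 2 * c k * ((waveVector k 0 : ℂ) ^ 2 + (waveVector k 1 : ℂ) ^ 2)) *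
    Complex.I_sq

theorem helmholtz_regTransport (α : ℝ) (f g : Coeffs) :
    helmholtz α (regTransport α f g) = transport f g := by
  funext k
  rw [helmholtz_apply, regTransport, mul_inv_cancel_left₀]
  exact Complex.ofReal_ne_zero.2 (helmholtzSymbol_pos α k).ne'

theorem helmholtz_injective (α : ℝ) : Function.Injective (helmholtz α) := by
  intro c d h
  funext k
  have hk := congrFun h k
  rw [helmholtz_apply, helmholtz_apply] at hk
  exact mul_left_cancel₀ (Complex.ofReal_ne_zero.2 (helmholtzSymbol_pos α k).ne') hk

/-- The advection term written in terms of the Fourier coefficients of `θ`. -/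
theorem neg_divergence_eq_transport {θ ψ : L2} {v : Fin 2 → L2}
    (hψ : sqrtNegLaplacian (fourierCoeffs ψ) = fourierCoeffs θ)
    (hv : ∀ j, fourierCoeffs (v j) = gradPerp (fourierCoeffs ψ) j) :
    (-divergence fun j => fourierCoeffs fun x => v j x * θ x) =
      transport (fourierCoeffs θ) (fourierCoeffs θ) := by
  funext k
  have h0 := (hasSum_fourierCoeffs_mul (v 0) θ k).mul_left (Complex.I * (waveVector k 0 : ℂ))
  have h1 := (hasSum_fourierCoeffs_mul (v 1) θ k).mul_left (Complex.I * (waveVector k 1 : ℂ))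
  have h := (h0.add h1).neg
  have hl : (-divergence fun j => fourierCoeffs fun x => v j x * θ x) k =
      -(Complex.I * (waveVector k 0 : ℂ) * fourierCoeffs (fun x => v 0 x * θ x) k +
        Complex.I * (waveVector k 1 : ℂ) * fourierCoeffs (fun x => v 1 x * θ x) k) := by
    simp [divergence, partialDeriv, Fin.sum_univ_two]
  rw [hl, ← h.tsum_eq, transport]
  refine tsum_congr fun j => ?_
  rw [hv 0, hv 1, ← hψ]
  simp only [gradPerp, partialDeriv, sqrtNegLaplacian, Matrix.cons_val_zero, Matrix.cons_val_one,
    Pi.neg_apply, transportSymbol]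
  by_cases hj : j = 0
  · simp [hj]
  have hne : (‖waveVector j‖ : ℂ) ≠ 0 :=
    Complex.ofReal_ne_zero.2 (norm_ne_zero_iff.2 (Hdot.waveVector_ne_zero hj))
  push_cast
  field_simp
  linear_combination (fourierCoeffs ψ j * ‖waveVector (k - j)‖ * fourierCoeffs ψ (k - j)) *
    ((waveVector k 0 : ℂ) * (waveVector j 1 : ℂ) -
      (waveVector k 1 : ℂ) * (waveVector j 0 : ℂ)) * Complex.I_sq

namespace Hdot

/-- The operator `1 - α² Δ : Ḣ^s → Ḣ^r` for `r + 2 ≤ s`. -/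
noncomputable def helmholtzCLM (α : ℝ) {s r : ℤ} (h : r + 2 ≤ s) : Hdot s →L[ℝ] Hdot r :=
  multiplier s r (helmholtzSymbol α) (helmholtzSymbol_neg α) (1 + α ^ 2) fun k hk => by
    have h1 := one_le_norm_waveVector hk
    have h2 : helmholtzSymbol α k ≤ (1 + α ^ 2) * ‖waveVector k‖ ^ 2 := by
      rw [helmholtzSymbol]
      linarith [one_le_pow₀ h1 (n := 2)]
    rw [abs_of_pos (helmholtzSymbol_pos α k)]
    calc ‖waveVector k‖ ^ r * helmholtzSymbol α k
        ≤ ‖waveVector k‖ ^ r * ((1 + α ^ 2) * ‖waveVector k‖ ^ 2) := by gcongr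
      _ = (1 + α ^ 2) * ‖waveVector k‖ ^ (r + 2) := by
        rw [zpow_add₀ (by linarith), zpow_ofNat]
        ring
      _ ≤ _ := by gcongr

@[simp]
theorem coeffs_helmholtzCLM (α : ℝ) {s r : ℤ} (h : r + 2 ≤ s) (c : Hdot s) :
    (helmholtzCLM α h c).coeffs = helmholtz α c.coeffs := by
  funext k
  rw [helmholtz_apply]
  rfl

theorem summable_norm_sq_coeffs {s : ℤ} (hs : 0 ≤ s) (c : Hdot s) :
    Summable fun k => ‖c.coeffs k‖ ^ 2 := by
  simpa using (inclusion hs c).summable_coeffs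

end Hdot

theorem mem_hdotSubmodule_of_memH {m : ℕ} {u : L2} (hmean : ∫ x, u x ∂torusMeasure = 0)
    (hu : MemH m u) : fourierCoeffs u ∈ hdotSubmodule m := by
  refine mem_hdotSubmodule_iff.2 ⟨(fourierCoeffs_zero_eq_zero_iff _).2 hmean,
    fourierCoeffs_neg u, .of_nonneg_of_le (fun k => sq_nonneg _) (fun k => ?_) hu⟩
  rw [zpow_natCast, mul_pow, ← pow_mul, mul_comm m 2, pow_mul]
  gcongr
  linarith

/-- Every solution of the problem is a solution of an ordinary differential equation in `Ḣ¹`,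
which appears as `Ḣ^{n+1}` with `n = 0`. -/
theorem IsRegularizedSolution.exists_hasDerivAt {α : ℝ} (hα : 0 < α) {θ₀ : L2} {θ : ℝ → L2}
    (h : IsRegularizedSolution α θ₀ θ) :
    ∃ u : ℝ → Hdot (0 + 1 : ℕ), (∀ t, (u t).coeffs = fourierCoeffs (θ t)) ∧
      ∀ t, HasDerivAt u (Hdot.nonlinearity hα 0 (u t) (u t)) t := by
  obtain ⟨U, hU, hUc⟩ := h.regular
  beta_reduce at hU
  obtain ⟨ψ, v, -, hψ, hv, Y, Z, hY, hZ, hYZ⟩ := h.evolution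
  beta_reduce at hY hZ
  let ι : Hdot 1 →L[ℝ] Hdot (0 + 1 : ℕ) := Hdot.inclusion (by simp)
  have hι : ∀ c, (ι c).coeffs = c.coeffs := Hdot.coeffs_inclusion _
  refine ⟨fun t => ι (U t), fun t => (hι _).trans (hU t), fun t => ?_⟩
  have hd : HasDerivAt U (deriv U t) t := (hUc.differentiable one_ne_zero t).hasDerivAt
  let A : Hdot 1 →L[ℝ] Hdot (-1) := Hdot.helmholtzCLM α (by norm_num)
  have hA : ∀ c, (A c).coeffs = helmholtz α c.coeffs := Hdot.coeffs_helmholtzCLM α _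
  have hAY : (fun t => A (U t)) = Y := by
    funext s
    ext1
    rw [hA, hU, hY]
  have hAd : A (deriv U t) = Z t := by
    have h1 := A.hasFDerivAt.comp_hasDerivAt t hd
    change HasDerivAt (fun t => A (U t)) _ t at h1
    rw [hAY] at h1
    exact h1.unique (hYZ t)
  have hval : ι (deriv U t) = Hdot.nonlinearity hα 0 (ι (U t)) (ι (U t)) := by
    ext1
    apply helmholtz_injective α
    rw [hι, Hdot.coeffs_nonlinearity, helmholtz_regTransport, hι, hU, ← hA, hAd, hZ,
      neg_divergence_eq_transport (hψ t) (hv t)]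
  rw [← hval]
  exact ι.hasFDerivAt.comp_hasDerivAt t hd

theorem IsRegularizedSolution.unique {α : ℝ} (hα : 0 < α) {θ₀ : L2} {θ η : ℝ → L2}
    (hθ : IsRegularizedSolution α θ₀ θ) (hη : IsRegularizedSolution α θ₀ η) : η = θ := by
  obtain ⟨u, hu, hud⟩ := hθ.exists_hasDerivAt hα
  obtain ⟨w, hw, hwd⟩ := hη.exists_hasDerivAt hα
  have h0 : w 0 = u 0 := by
    ext1
    rw [hw, hu, hη.initial, hθ.initial]
  have heq := Hdot.eq_of_hasDerivAt hα hwd hud h0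
  funext t
  apply fourierCoeffs_injective
  rw [← hw, ← hu, heq]

/-- The stream function and the velocity of a square integrable function of mean zero. -/
theorem exists_streamFunction {c : Coeffs} (hc0 : c 0 = 0) (hconj : ∀ k, c (-k) = conj (c k))
    (hc : Summable fun k => ‖c k‖ ^ 2) :
    ∃ (ψ : L2) (v : Fin 2 → L2), ∫ x, ψ x ∂torusMeasure = 0 ∧
      sqrtNegLaplacian (fourierCoeffs ψ) = c ∧
      ∀ j, fourierCoeffs (v j) = gradPerp (fourierCoeffs ψ) j := by
  have hle : ∀ k (ξ : ℝ), |ξ| ≤ ‖waveVector k‖ →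
      ‖(ξ : ℂ) * ((‖waveVector k‖⁻¹ : ℝ) * c k)‖ ^ 2 ≤ ‖c k‖ ^ 2 := by
    intro k ξ hξ
    by_cases hk : k = 0
    · simp [hk, hc0]
    have hpos : 0 < ‖waveVector k‖ := by linarith [one_le_norm_waveVector hk]
    gcongr
    rw [← mul_assoc, ← Complex.ofReal_mul, norm_mul, Complex.norm_real, Real.norm_eq_abs, abs_mul,
      abs_of_pos (inv_pos.2 hpos)]
    refine mul_le_of_le_one_left (norm_nonneg _) ?_
    rw [← div_eq_mul_inv, div_le_one hpos]
    exact hξ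
  have hcoord : ∀ k (j : Fin 2), |waveVector k j| ≤ ‖waveVector k‖ := fun k j =>
    PiLp.norm_apply_le (waveVector k) j
  obtain ⟨ψ, hψ⟩ := exists_fourierCoeffs_eq (c := fun k => ((‖waveVector k‖⁻¹ : ℝ) : ℂ) * c k)
    (fun k => by simp [waveVector_neg, hconj]) (.of_nonneg_of_le (fun k => sq_nonneg _)
      (fun k => by
        by_cases hk : k = 0
        · simp [hk, hc0]
        · simpa using hle k 1 (by simpa using one_le_norm_waveVector hk)) hc)
  have hpartial : ∀ j, (∀ k, partialDeriv j (fourierCoeffs ψ) (-k) =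
      conj (partialDeriv j (fourierCoeffs ψ) k)) ∧
      Summable fun k => ‖partialDeriv j (fourierCoeffs ψ) k‖ ^ 2 := by
    refine fun j => ⟨fun k => ?_, .of_nonneg_of_le (fun k => sq_nonneg _) (fun k => ?_) hc⟩
    · simp [partialDeriv, fourierCoeffs_neg, waveVector_neg]
    · refine le_trans (le_of_eq ?_) (hle k _ (hcoord k j))
      rw [partialDeriv, hψ, mul_assoc, norm_mul, Complex.norm_I, one_mul]
  have hv : ∀ j, ∃ w : L2, fourierCoeffs w = gradPerp (fourierCoeffs ψ) j := by
    rw [Fin.forall_fin_two]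
    refine ⟨exists_fourierCoeffs_eq (fun k => ?_) ?_,
      exists_fourierCoeffs_eq (hpartial 0).1 (hpartial 0).2⟩
    · simp [gradPerp, (hpartial 1).1]
    · simpa [gradPerp] using (hpartial 1).2
  choose v hv using hv
  refine ⟨ψ, v, ?_, ?_, hv⟩
  · rw [← fourierCoeffs_zero_eq_zero_iff, hψ]
    simp [hc0]
  · funext k
    rw [sqrtNegLaplacian, hψ]
    by_cases hk : k = 0
    · simp [hk, hc0]
    · have hne : (‖waveVector k‖ : ℂ) ≠ 0 :=
        Complex.ofReal_ne_zero.2 (norm_ne_zero_iff.2 (Hdot.waveVector_ne_zero hk))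
      push_cast
      rw [mul_inv_cancel_left₀ hne]

/-- A solution of the ordinary differential equation in `Ḣ^{n+1}` is a global solution of the
problem, with the asserted regularity. -/
theorem exists_isRegularizedSolution {α : ℝ} (hα : 0 < α) {n : ℕ} {θ₀ : L2}
    {u : ℝ → Hdot (n + 1 : ℕ)} (hu0 : (u 0).coeffs = fourierCoeffs θ₀)
    (hu : ∀ t, HasDerivAt u (Hdot.nonlinearity hα n (u t) (u t)) t) :
    ∃ θ : ℝ → L2, IsRegularizedSolution α θ₀ θ ∧
      IsC1In (n + 1 : ℕ) (fun t => fourierCoeffs (θ t)) ∧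
      IsC1In ((n + 1 : ℕ) - 2) (fun t => helmholtz α (fourierCoeffs (θ t))) := by
  have hC1 : ContDiff ℝ 1 u := by
    have hcont : Continuous u := continuous_iff_continuousAt.2 fun t => (hu t).continuousAt
    rw [contDiff_one_iff_deriv]
    refine ⟨fun t => (hu t).differentiableAt, ?_⟩
    rw [show deriv u = fun t => Hdot.nonlinearity hα n (u t) (u t) from
      funext fun t => (hu t).deriv]
    exact ((Hdot.nonlinearity hα n).continuous.comp hcont).clm_apply hcont
  choose θ hθ using fun t => exists_fourierCoeffs_eq (u t).coeffs_neg_apply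
    ((u t).summable_norm_sq_coeffs (by positivity))
  have hone : (1 : ℤ) ≤ (n + 1 : ℕ) := by push_cast; linarith
  refine ⟨θ, ⟨?_, fun t => ?_, ?_, ?_⟩, ?_, ?_⟩
  · apply fourierCoeffs_injective
    rw [hθ, hu0]
  · rw [← fourierCoeffs_zero_eq_zero_iff, hθ, Hdot.coeffs_zero_apply]
  · exact ⟨fun t => Hdot.inclusion hone (u t), fun t => by simp only [Hdot.coeffs_inclusion, hθ],
      (Hdot.inclusion hone).contDiff.comp hC1⟩
  · choose ψ v hψ0 hψ hv using fun t => exists_streamFunction (u t).coeffs_zero_apply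
      (u t).coeffs_neg_apply ((u t).summable_norm_sq_coeffs (by positivity))
    let A : Hdot (n + 1 : ℕ) →L[ℝ] Hdot (-1) := Hdot.helmholtzCLM α (by push_cast; linarith)
    have hA : ∀ c, (A c).coeffs = helmholtz α c.coeffs := Hdot.coeffs_helmholtzCLM α _
    refine ⟨ψ, v, hψ0, fun t => by rw [hψ, hθ], hv, fun t => A (u t),
      fun t => A (Hdot.nonlinearity hα n (u t) (u t)), fun t => by simp only [hA, hθ], fun t => ?_,
      fun t => A.hasFDerivAt.comp_hasDerivAt t (hu t)⟩
    beta_reduce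
    rw [neg_divergence_eq_transport ((hψ t).trans (hθ t).symm) (hv t), hA,
      Hdot.coeffs_nonlinearity, helmholtz_regTransport, hθ]
  · exact ⟨u, fun t => (hθ t).symm, hC1⟩
  · exact ⟨fun t => Hdot.helmholtzCLM α (by linarith) (u t),
      fun t => by simp only [Hdot.coeffs_helmholtzCLM, hθ],
      (Hdot.helmholtzCLM α (by linarith)).contDiff.comp hC1⟩

end SQG

/-- Global regularity for the regularized surface quasi-geostrophic equations. -/
theorem theorem2 (α : ℝ) (hα : 0 < α) (m : ℕ) (hm : 1 ≤ m) (θ₀ : SQG.L2)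
    (hθ₀ : SQG.MemH m θ₀) (hmean : ∫ x, θ₀ x ∂SQG.torusMeasure = 0) :
    ∃ θ : ℝ → SQG.L2,
      SQG.IsRegularizedSolution α θ₀ θ ∧
      (∀ η : ℝ → SQG.L2, SQG.IsRegularizedSolution α θ₀ η → η = θ) ∧
      SQG.IsC1In (m : ℤ) (fun t => SQG.fourierCoeffs (θ t)) ∧
      SQG.IsC1In ((m : ℤ) - 2) (fun t => SQG.helmholtz α (SQG.fourierCoeffs (θ t))) := by
  obtain ⟨n, rfl⟩ := Nat.exists_eq_add_of_le' hm
  obtain ⟨u, hu0, hu⟩ := SQG.Hdot.exists_global_solution hα n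
    (SQG.Hdot.mk (SQG.fourierCoeffs θ₀) (SQG.mem_hdotSubmodule_of_memH hmean hθ₀))
  obtain ⟨θ, hθ, h1, h2⟩ := SQG.exists_isRegularizedSolution hα (θ₀ := θ₀)
    (by rw [hu0, SQG.Hdot.coeffs_mk]) hu
  exact ⟨θ, hθ, fun η hη => hθ.unique hα hη, h1, h2⟩
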